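/- Let $p$ be a prime and $\mathbb{Z}[\tfrac1p]\subset\mathbb{Q}$ the subring generated by $\tfrac1p$. Let $$\tilde G_p=\left\{\begin{bmatrix}1&x_{12}&x_{13}&x_{14}&x_{15}\\0&p^n&x_{23}&x_{24}&x_{25}\\0&0&p^k&x_{34}&x_{35}\\0&0&0&1&m\\0&0&0&0&1\end{bmatrix}: x_{ij}\in\mathbb{Z}[\tfrac1p],\ k,n,m\in\mathbb{Z}\right\},$$ a group under matrix multiplication, and let $G\le\tilde G_p$ be the subgroup of matrices with $m=0$. Then $\tilde G_p$ is finitely presented. More precisely, for $s\in\{3,4\}$ let $H_s$ be the group with generators $d_2$, $d_3$ and $e_{ij}$ for $1\le i\le s$, $i<j\le 5$, subject to the following relations, where $[x,y]=xyx^{-1}y^{-1}$ and all $e_{ij}$ that occur are generators: 1. $[d_2,d_3]=1$; $d_2e_{2j}d_2^{-1}=e_{2j}^p$ for $j=3,4,5$; $d_2^{-1}e_{12}d_2=e_{12}^p$; and $[d_2,e_{ij}]=1$ for all other pairs $(i,j)$. 2. $d_3e_{3j}d_3^{-1}=e_{3j}^p$ for $j=4,5$; $d_3^{-1}e_{i3}d_3=e_{i3}^p$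 for $i=1,2$; and $[d_3,e_{ij}]=1$ for all other pairs $(i,j)$. 3. For $i\le k$: $[e_{ij},e_{k\ell}]=1$ if $j\ne k$, and $[e_{ij},e_{k\ell}]=e_{i\ell}$ if $j=k$. Then there are group isomorphisms $H_3\to G$ and $H_4\to\tilde G_p$, each of which sends $d_2\mapsto\mathrm{diag}(1,p,1,1,1)$, $d_3\mapsto\mathrm{diag}(1,1,p,1,1)$, and $e_{ij}\mapsto 1+\mathbf e_{ij}$, where $\mathbf e_{ij}$ is the matrix unit with $1$ in position $(i,j)$. -/

import Mathlib

open scoped MatrixGroups commutatorElement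

/-- The ring `ℤ[1/p]`, as a subring of `ℚ`. -/
def ZInv (p : ℕ) : Subring ℚ := Subring.closure {(p : ℚ)⁻¹}

theorem ZInv.zpow_mem (p : ℕ) (n : ℤ) : (p : ℚ) ^ n ∈ ZInv p := by
  have h1 : (p : ℚ) ∈ ZInv p := natCast_mem _ p
  have h2 : (p : ℚ)⁻¹ ∈ ZInv p := Subring.subset_closure rfl
  cases n with
  | ofNat n => simpa using pow_mem h1 n
  | negSucc n => simpa [zpow_negSucc, inv_pow] using pow_mem h2 (n + 1)

/-- The matrices that make up the group `G̃_p`. -/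
def IsGTildeMatrix (p : ℕ) (A : Matrix (Fin 5) (Fin 5) ℚ) : Prop :=
  ∃ x₁₂ ∈ ZInv p, ∃ x₁₃ ∈ ZInv p, ∃ x₁₄ ∈ ZInv p, ∃ x₁₅ ∈ ZInv p,
  ∃ x₂₃ ∈ ZInv p, ∃ x₂₄ ∈ ZInv p, ∃ x₂₅ ∈ ZInv p,
  ∃ x₃₄ ∈ ZInv p, ∃ x₃₅ ∈ ZInv p, ∃ n k m : ℤ,
    A = !![1, x₁₂, x₁₃, x₁₄, x₁₅;
           0, (p : ℚ) ^ n, x₂₃, x₂₄, x₂₅;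
           0, 0, (p : ℚ) ^ k, x₃₄, x₃₅;
           0, 0, 0, 1, (m : ℚ);
           0, 0, 0, 0, 1]

theorem IsGTildeMatrix.one (p : ℕ) : IsGTildeMatrix p 1 := by
  refine ⟨0, zero_mem _, 0, zero_mem _, 0, zero_mem _, 0, zero_mem _, 0, zero_mem _,
    0, zero_mem _, 0, zero_mem _, 0, zero_mem _, 0, zero_mem _, 0, 0, 0, ?_⟩
  ext i j
  fin_cases i <;> fin_cases j <;> simp

theorem IsGTildeMatrix.mul {p : ℕ} [Fact p.Prime] {A B : Matrix (Fin 5) (Fin 5) ℚ}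
    (hA : IsGTildeMatrix p A) (hB : IsGTildeMatrix p B) : IsGTildeMatrix p (A * B) := by
  have hp : (p : ℚ) ≠ 0 := Nat.cast_ne_zero.mpr (Fact.out : p.Prime).ne_zero
  obtain ⟨x₁₂, h₁₂, x₁₃, h₁₃, x₁₄, h₁₄, x₁₅, h₁₅, x₂₃, h₂₃, x₂₄, h₂₄, x₂₅, h₂₅,
    x₃₄, h₃₄, x₃₅, h₃₅, n, k, m, rfl⟩ := hA
  obtain ⟨y₁₂, g₁₂, y₁₃, g₁₃, y₁₄, g₁₄, y₁₅, g₁₅, y₂₃, g₂₃, y₂₄, g₂₄, y₂₅, g₂₅,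
    y₃₄, g₃₄, y₃₅, g₃₅, n', k', m', rfl⟩ := hB
  have a1 := ZInv.zpow_mem p n
  have a2 := ZInv.zpow_mem p k
  have b1 := ZInv.zpow_mem p n'
  have b2 := ZInv.zpow_mem p k'
  have c1 : (m : ℚ) ∈ ZInv p := intCast_mem _ m
  have c2 : (m' : ℚ) ∈ ZInv p := intCast_mem _ m'
  refine ⟨y₁₂ + x₁₂ * p ^ n', ?_, y₁₃ + x₁₂ * y₂₃ + x₁₃ * p ^ k', ?_,
    y₁₄ + x₁₂ * y₂₄ + x₁₃ * y₃₄ + x₁₄, ?_,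
    y₁₅ + x₁₂ * y₂₅ + x₁₃ * y₃₅ + x₁₄ * m' + x₁₅, ?_,
    p ^ n * y₂₃ + x₂₃ * p ^ k', ?_, p ^ n * y₂₄ + x₂₃ * y₃₄ + x₂₄, ?_,
    p ^ n * y₂₅ + x₂₃ * y₃₅ + x₂₄ * m' + x₂₅, ?_,
    p ^ k * y₃₄ + x₃₄, ?_, p ^ k * y₃₅ + x₃₄ * m' + x₃₅, ?_, n + n', k + k', m' + m, ?_⟩
  case refine_10 =>
    ext i j
    fin_cases i <;> fin_cases j <;>
      simp [Matrix.mul_apply, Fin.sum_univ_five, zpow_add₀ hp]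
  all_goals repeat' first | assumption | apply add_mem | apply mul_mem

theorem IsGTildeMatrix.exists_mul_eq_one {p : ℕ} [Fact p.Prime] {A : Matrix (Fin 5) (Fin 5) ℚ}
    (hA : IsGTildeMatrix p A) : ∃ B, IsGTildeMatrix p B ∧ A * B = 1 := by
  have hp : (p : ℚ) ≠ 0 := Nat.cast_ne_zero.mpr (Fact.out : p.Prime).ne_zero
  obtain ⟨x₁₂, h₁₂, x₁₃, h₁₃, x₁₄, h₁₄, x₁₅, h₁₅, x₂₃, h₂₃, x₂₄, h₂₄, x₂₅, h₂₅,
    x₃₄, h₃₄, x₃₅, h₃₅, n, k, m, rfl⟩ := hA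
  have a1 := ZInv.zpow_mem p (-n)
  have a2 := ZInv.zpow_mem p (-k)
  have hn : (p : ℚ) ^ n * p ^ (-n) = 1 := by rw [← zpow_add₀ hp]; simp
  have hk : (p : ℚ) ^ k * p ^ (-k) = 1 := by rw [← zpow_add₀ hp]; simp
  have c1 : (m : ℚ) ∈ ZInv p := intCast_mem _ m
  generalize ha : (p : ℚ) ^ (-n) = a at a1 hn
  generalize hb : (p : ℚ) ^ (-k) = b at a2 hk
  obtain ⟨u₁₂, e₁₂⟩ : ∃ u, u = -(x₁₂ * a) := ⟨_, rfl⟩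
  obtain ⟨u₂₃, e₂₃⟩ : ∃ u, u = -(a * (x₂₃ * b)) := ⟨_, rfl⟩
  obtain ⟨u₁₃, e₁₃⟩ : ∃ u, u = -(x₁₂ * u₂₃ + x₁₃ * b) := ⟨_, rfl⟩
  obtain ⟨u₃₄, e₃₄⟩ : ∃ u, u = -(b * x₃₄) := ⟨_, rfl⟩
  obtain ⟨u₂₄, e₂₄⟩ : ∃ u, u = -(a * (x₂₃ * u₃₄ + x₂₄)) := ⟨_, rfl⟩
  obtain ⟨u₁₄, e₁₄⟩ : ∃ u, u = -(x₁₂ * u₂₄ + x₁₃ * u₃₄ + x₁₄) := ⟨_, rfl⟩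
  obtain ⟨u₃₅, e₃₅⟩ : ∃ u, u = -(b * (-(x₃₄ * m) + x₃₅)) := ⟨_, rfl⟩
  obtain ⟨u₂₅, e₂₅⟩ : ∃ u, u = -(a * (x₂₃ * u₃₅ + -(x₂₄ * m) + x₂₅)) := ⟨_, rfl⟩
  obtain ⟨u₁₅, e₁₅⟩ : ∃ u, u = -(x₁₂ * u₂₅ + x₁₃ * u₃₅ + -(x₁₄ * m) + x₁₅) := ⟨_, rfl⟩
  refine ⟨_, ⟨u₁₂, ?_, u₁₃, ?_, u₁₄, ?_, u₁₅, ?_, u₂₃, ?_, u₂₄, ?_, u₂₅, ?_,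
    u₃₄, ?_, u₃₅, ?_, -n, -k, -m, rfl⟩, ?_⟩
  case refine_10 =>
    rw [ha, hb]
    ext i j
    fin_cases i <;> fin_cases j <;>
      simp [Matrix.mul_apply, Fin.sum_univ_five, hn, hk] <;> subst_vars <;> grind
  all_goals
    subst_vars
    repeat' first | assumption | apply neg_mem | apply add_mem | apply mul_mem

/-- The group `G̃_p`, as a group of invertible matrices. -/
def GTilde (p : ℕ) [Fact p.Prime] : Subgroup (GL (Fin 5) ℚ) where
  carrier := {g | IsGTildeMatrix p g.val}
  one_mem' := IsGTildeMatrix.one p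
  mul_mem' hg hh := IsGTildeMatrix.mul hg hh
  inv_mem' {g} hg := by
    obtain ⟨B, hB, h⟩ := IsGTildeMatrix.exists_mul_eq_one hg
    change IsGTildeMatrix p (g⁻¹).val
    rwa [Units.inv_eq_of_mul_eq_one_right h]

/-- The subgroup `G` of `G̃_p` of the matrices with `(4,5)` entry `m = 0`. -/
def GZero (p : ℕ) [Fact p.Prime] : Subgroup (GL (Fin 5) ℚ) where
  carrier := {g | g ∈ GTilde p ∧ g.val 3 4 = 0}
  one_mem' := ⟨one_mem _, by simp⟩
  mul_mem' {g h} hg hh := by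
    refine ⟨mul_mem hg.1 hh.1, ?_⟩
    obtain ⟨⟨_, _, _, _, _, _, _, _, _, _, _, _, _, _, _, _, _, _, _, _, _, e⟩, hg0⟩ := hg
    have h0 := hh.2
    simp only [Units.val_mul, Matrix.mul_apply, Fin.sum_univ_five, h0, hg0]
    rw [e]
    simp
  inv_mem' {g} hg := by
    refine ⟨inv_mem hg.1, ?_⟩
    obtain ⟨⟨_, _, _, _, _, _, _, _, _, _, _, _, _, _, _, _, _, _, _, _, _, e⟩, hg0⟩ := hg
    have h := congrFun (congrFun (g.mul_inv) 3) 4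
    have h' := congrFun (congrFun (g.mul_inv) 4) 4
    simp only [Matrix.mul_apply, Fin.sum_univ_five, hg0] at h h'
    rw [e] at h
    simpa using h

/-- The generators `d₂`, `d₃` and `e_{ij}` with `1 ≤ i ≤ s`, `i < j ≤ 5`. Since `Fin 5` starts at
`0`, the letter `e_{ij}` is `e (i - 1) (j - 1)`. -/
inductive AbelsGen (s : ℕ) : Type
  | d₂ : AbelsGen s
  | d₃ : AbelsGen s
  | e (i j : Fin 5) (h : i < j ∧ i.val < s) : AbelsGen s

namespace AbelsGen

/-- The letter `d₂` in the free group. -/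
def D₂ (s : ℕ) : FreeGroup (AbelsGen s) := FreeGroup.of d₂

/-- The letter `d₃` in the free group. -/
def D₃ (s : ℕ) : FreeGroup (AbelsGen s) := FreeGroup.of d₃

/-- The letters `e_{ij}` in the free group (indices shifted by one). -/
def E {s : ℕ} (i j : Fin 5) (h : i < j ∧ i.val < s) : FreeGroup (AbelsGen s) :=
  FreeGroup.of (e i j h)

end AbelsGen

open AbelsGen in
/-- The defining relators; a relation `u = v` is the relator `u * v⁻¹`, and
`⁅x, y⁆ = x * y * x⁻¹ * y⁻¹`. Indices are shifted by one, so that `d₂` goes with the index `1` and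
`d₃` with the index `2`. -/
inductive AbelsRelator (p s : ℕ) : FreeGroup (AbelsGen s) → Prop
  | d₂_d₃ : AbelsRelator p s ⁅D₂ s, D₃ s⁆
  | d₂_row (j : Fin 5) (h : 1 < j ∧ (1 : Fin 5).val < s) :
      AbelsRelator p s (D₂ s * E 1 j h * (D₂ s)⁻¹ * (E 1 j h ^ p)⁻¹)
  | d₂_col (i : Fin 5) (h : i < 1 ∧ i.val < s) :
      AbelsRelator p s ((D₂ s)⁻¹ * E i 1 h * D₂ s * (E i 1 h ^ p)⁻¹)
  | d₂_comm (i j : Fin 5) (h : i < j ∧ i.val < s) (hi : i ≠ 1) (hj : j ≠ 1) :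
      AbelsRelator p s ⁅D₂ s, E i j h⁆
  | d₃_row (j : Fin 5) (h : 2 < j ∧ (2 : Fin 5).val < s) :
      AbelsRelator p s (D₃ s * E 2 j h * (D₃ s)⁻¹ * (E 2 j h ^ p)⁻¹)
  | d₃_col (i : Fin 5) (h : i < 2 ∧ i.val < s) :
      AbelsRelator p s ((D₃ s)⁻¹ * E i 2 h * D₃ s * (E i 2 h ^ p)⁻¹)
  | d₃_comm (i j : Fin 5) (h : i < j ∧ i.val < s) (hi : i ≠ 2) (hj : j ≠ 2) :
      AbelsRelator p s ⁅D₃ s, E i j h⁆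
  | e_comm (i j k l : Fin 5) (h : i < j ∧ i.val < s) (h' : k < l ∧ k.val < s)
      (hik : i ≤ k) (hjk : j ≠ k) : AbelsRelator p s ⁅E i j h, E k l h'⁆
  | e_mul (i j l : Fin 5) (h : i < j ∧ i.val < s) (h' : j < l ∧ j.val < s)
      (h'' : i < l ∧ i.val < s) : AbelsRelator p s (⁅E i j h, E j l h'⁆ * (E i l h'')⁻¹)

/-- The group with generators `d₂`, `d₃`, `e_{ij}` (`1 ≤ i ≤ s`, `i < j ≤ 5`) and the relators
above. -/
abbrev AbelsPresented (p s : ℕ) : Type := PresentedGroup {r | AbelsRelator p s r}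

/-- `φ` sends `d₂` to `diag(1,p,1,1,1)`, `d₃` to `diag(1,1,p,1,1)` and each `e_{ij}` to the
elementary matrix with `1` in position `(i,j)`. -/
def IsStandardOnGenerators {p s : ℕ} {H : Subgroup (GL (Fin 5) ℚ)}
    (φ : AbelsPresented p s ≃* H) : Prop :=
  (φ (PresentedGroup.of AbelsGen.d₂)).val.val = Matrix.diagonal ![1, (p : ℚ), 1, 1, 1] ∧
  (φ (PresentedGroup.of AbelsGen.d₃)).val.val = Matrix.diagonal ![1, 1, (p : ℚ), 1, 1] ∧
  ∀ (i j : Fin 5) (h : i < j ∧ i.val < s),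
    (φ (PresentedGroup.of (AbelsGen.e i j h))).val.val = 1 + Matrix.single i j (1 : ℚ)

/-!
Write `D` for the group generated by `d₂` and `d₃`, and number rows and columns from `0`. Sending
the generators to the prescribed matrices respects the relations, which gives the homomorphism
`AbelsMatrix.toGL`. Its image is easily found; the content is that it is injective.

For three rows, let `root p i j` be generated by the `D`-conjugates of `e_{ij}`. The group `D` acts
on `e_{01}` and `e_{1c}` through `d₂` alone, on `e_{02}` and `e_{2c}` through `d₃` alone, and on
`e_{12}` through its quotient by `d₂ d₃` (here `c` is `3` or `4`). Given two of the `e_{ij}` from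
different classes, any two conjugates of them under `D` are conjugate simultaneously to the original
pair (`Subgroup.IndependentWeights`). Hence the relation for `⁅e_{ij}, e_{kl}⁆` passes to
the root subgroups. Two columns `c`, `c'` of one row have the same weight, and there the relation
passes to the root subgroups because conjugation by `d₂` or `d₃` brings any two given elements to
powers of the generators.

The pairs of opposite weight, `(0, 1)` with `(1, c)` and `(0, 2)` with `(2, c)`, remain. Their
commutators have weight zero, and they fill a copy of `ℤ[1/p]` at the position `(0, c)`, where
conjugates of `e_{0c}` yield only `ℤ`. So `centralRoot p c` is defined as
`⁅root p 0 1, root p 1 c⁆`. The Hall–Witt identity in the form `⁅x, ⁅y, z⁆⁆ = ⁅⁅x, y⁆, z⁆` shows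
that it is also `⁅root p 0 2, root p 2 c⁆` (`AbelsPresented.centralRoot_eq`). From the two
descriptions it commutes with all root subgroups, and its elements are the `⁅x, e_{1c}⁆` with `x` in
`root p 0 1` (`AbelsPresented.exists_of_mem_centralRoot`).

Therefore every element is a product of an element of `D` and one element of each root subgroup,
ordered from the last row to the first (`AbelsPresented.exists_rows`). In that order the product of
the unipotent factors has as its matrix entries just the entries of the factors. The representation
is injective on `D` and on each root subgroup, which are unions of cyclic groups, so it is
injective (`AbelsMatrix.toGL_injective`).

For four rows, `e_{34}` normalises the image of the group with three rows, so every element is a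
power of `e_{34}` times an element of that image, and the exponent is read off from the entry
`(3, 4)`.
-/

/-! ### Commutators of subgroups -/

namespace Subgroup

variable {G : Type*} [Group G]

theorem commute_of_commutator_eq_bot {H K : Subgroup G} (h : ⁅H, K⁆ = ⊥) {x y : G}
    (hx : x ∈ H) (hy : y ∈ K) : Commute x y :=
  commutatorElement_eq_one_iff_commute.1 <| mem_bot.1 <| h ▸ commutator_mem_commutator hx hy

theorem commutator_eq_bot_of_commute {H K : Subgroup G}
    (h : ∀ x ∈ H, ∀ y ∈ K, Commute x y) : ⁅H, K⁆ = ⊥ :=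
  le_bot_iff.1 <| commutator_le.2 fun x hx y hy ↦ mem_bot.2 (h x hx y hy).commutator_eq

theorem le_normalizer_of_commutator_eq_bot {H K : Subgroup G} (h : ⁅H, K⁆ = ⊥) :
    H ≤ normalizer (K : Set G) :=
  le_normalizer_iff_commutator_le_right.2 (h ▸ bot_le)

theorem commutator_closure_le {S T : Set G} {W : Subgroup G}
    (hS : closure S ≤ normalizer (W : Set G)) (hT : closure T ≤ normalizer (W : Set G))
    (h : ∀ s ∈ S, ∀ t ∈ T, ⁅s, t⁆ ∈ W) : ⁅closure S, closure T⁆ ≤ W := by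
  have hS' := le_normalizer_iff.1 hS
  have hT' := le_normalizer_iff.1 hT
  have key : ∀ s ∈ S, ∀ y ∈ closure T, ⁅s, y⁆ ∈ W := by
    intro s hs y hy
    induction hy using closure_induction with
    | mem t ht => exact h s hs t ht
    | one => simp
    | mul x y hx hy ihx ihy =>
      rw [commutatorElement_mul_right_eq_mul_conj]
      simpa only [mul_assoc] using mul_mem ihx (hT' x hx _ ihy)
    | inv x hx ih =>
      rw [commutatorElement_inv_right, ← commutatorElement_inv s x]
      simpa using hT' x⁻¹ (inv_mem hx) _ (inv_mem ih)
  refine commutator_le.2 fun x hx y hy ↦ ?_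
  induction hx using closure_induction with
  | mem s hs => exact key s hs y hy
  | one => simp
  | mul x z hx hz ihx ihz =>
    rw [commutatorElement_mul_left_eq_conj_mul]
    exact mul_mem (hS' x hx _ ihz) ihx
  | inv x hx ih =>
    rw [commutatorElement_inv_left, ← commutatorElement_inv x y]
    simpa using hS' x⁻¹ (inv_mem hx) _ (inv_mem ih)

theorem commutator_sup_le {K R R' S : Subgroup G} (hR : R ≤ S) (h : ⁅K, R⁆ ≤ S) (hR' : R' ≤ S)
    (h' : ⁅K, R'⁆ ≤ S) : ⁅K, R ⊔ R'⁆ ≤ S := by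
  refine commutator_le.2 fun k hk r hr ↦ ?_
  have : R ⊔ R' ≤ S.comap (MulAut.conj k).toMonoidHom := by
    refine sup_le (fun r hr ↦ ?_) fun r hr ↦ ?_
    · have := mul_mem (h (commutator_mem_commutator hk hr)) (hR hr)
      simpa [commutatorElement_def] using this
    · have := mul_mem (h' (commutator_mem_commutator hk hr)) (hR' hr)
      simpa [commutatorElement_def] using this
  rw [commutatorElement_def]
  exact mul_mem (this hr) (inv_mem (sup_le hR hR' hr))

theorem left_mem_closure_pair (a b : G) : a ∈ closure {a, b} :=
  subset_closure (by simp)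

theorem right_mem_closure_pair (a b : G) : b ∈ closure {a, b} :=
  subset_closure (by simp)

theorem le_normalizer_sup {D H K : Subgroup G}
    (hH : D ≤ normalizer (H : Set G)) (hK : D ≤ normalizer (K : Set G)) :
    D ≤ normalizer ((H ⊔ K : Subgroup G) : Set G) :=
  (le_inf hH hK).trans (normalizer_inf_normalizer_le_normalizer_sup H K)

theorem exists_mul_of_mem_sup {H N : Subgroup G} (h : H ≤ normalizer (N : Set G)) {x : G}
    (hx : x ∈ H ⊔ N) : ∃ a ∈ H, ∃ b ∈ N, x = a * b := by
  rw [← SetLike.mem_coe, coe_mul_of_left_le_normalizer_right _ _ h] at hx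
  obtain ⟨a, ha, b, hb, rfl⟩ := hx
  exact ⟨a, ha, b, hb, rfl⟩

theorem commutator_commutator_eq_bot {H K L : Subgroup G} (hK : ⁅H, K⁆ = ⊥) (hL : ⁅H, L⁆ = ⊥) :
    ⁅H, ⁅K, L⁆⁆ = ⊥ := by
  rw [commutator_comm]
  refine commutator_commutator_eq_bot_of_rotate ?_ ?_
  · rw [commutator_comm L, hL, commutator_bot_left]
  · rw [hK, commutator_bot_left]

theorem le_normalizer_commutator_of_commute {H K L : Subgroup G} (hK : ⁅H, K⁆ = ⊥)
    (hL : ⁅H, L⁆ = ⊥) : H ≤ normalizer (⁅K, L⁆ : Subgroup G) :=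
  le_normalizer_of_commutator_eq_bot (commutator_commutator_eq_bot hK hL)

/-- The form that the Hall–Witt identity takes when `x` centralises `z`, and `⁅y, z⁆` centralises
`⁅x, y⁆` and `z`. -/
theorem _root_.commutatorElement_assoc {x y z : G} (hxz : Commute x z)
    (hc : Commute ⁅y, z⁆ ⁅x, y⁆) (hz : Commute ⁅y, z⁆ z) :
    ⁅x, ⁅y, z⁆⁆ = ⁅⁅x, y⁆, z⁆ := by
  have h1 : x * ⁅y, z⁆ * x⁻¹ = ⁅⁅x, y⁆ * y, z⁆ := by
    rw [conjugate_commutatorElement, hxz.eq, mul_inv_cancel_right]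
    congr 1
    simp [commutatorElement_def]
  have h2 : Commute ⁅y, z⁆ ⁅⁅x, y⁆, z⁆ := by
    rw [commutatorElement_def ⁅x, y⁆]
    exact ((hc.mul_right hz).mul_right hc.inv_right).mul_right hz.inv_right
  rw [commutatorElement_def x, h1, commutatorElement_mul_left_eq_conj_mul, ← hc.eq,
    mul_inv_cancel_right, h2.eq, mul_inv_cancel_right]

/-! ### Subgroups generated by the conjugates of an element under a torus -/

/-- The subgroup generated by the conjugates of `e` by the elements of `D`. -/
def conjClosure (D : Subgroup G) (e : G) : Subgroup G :=
  closure {x | ∃ d ∈ D, x = d * e * d⁻¹}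

variable {D : Subgroup G} {e e' : G}

theorem self_mem_conjClosure : e ∈ conjClosure D e :=
  subset_closure ⟨1, one_mem _, by simp⟩

theorem conj_mem_conjClosure {d : G} (hd : d ∈ D) : d * e * d⁻¹ ∈ conjClosure D e :=
  subset_closure ⟨d, hd, rfl⟩

theorem le_normalizer_conjClosure : D ≤ normalizer (conjClosure D e : Set G) := by
  refine le_normalizer_closure_iff.2 ?_
  rintro d hd _ ⟨c, hc, rfl⟩
  exact subset_closure ⟨d * c, mul_mem hd hc, by group⟩

theorem le_normalizer_commutator {H K : Subgroup G} (hH : D ≤ normalizer (H : Set G))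
    (hK : D ≤ normalizer (K : Set G)) : D ≤ normalizer (⁅H, K⁆ : Subgroup G) := by
  rw [commutator_def]
  refine le_normalizer_closure_iff.2 ?_
  rintro d hd _ ⟨x, hx, y, hy, rfl⟩
  rw [conjugate_commutatorElement]
  exact commutator_mem_commutator (le_normalizer_iff.1 hH d hd x hx)
    (le_normalizer_iff.1 hK d hd y hy)

theorem commute_of_mem_conjClosure {a x : G} (hD : ∀ d ∈ D, Commute d a) (ha : Commute a e)
    (hx : x ∈ conjClosure D e) : Commute a x := by
  induction hx using closure_induction with
  | mem x hx =>
    obtain ⟨d, hd, rfl⟩ := hx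
    exact ((hD d hd).symm.mul_right ha).mul_right (hD d hd).symm.inv_right
  | one => exact Commute.one_right _
  | mul x y _ _ hx hy => exact hx.mul_right hy
  | inv x _ hx => exact hx.inv_right

/-- Two elements have independent weights for `D` if any pair of conjugates under `D` is
obtained by simultaneous conjugation. -/
def IndependentWeights (D : Subgroup G) (e e' : G) : Prop :=
  ∀ d ∈ D, ∀ d' ∈ D, ∃ c ∈ D, c * e * c⁻¹ = d * e * d⁻¹ ∧ c * e' * c⁻¹ = d' * e' * d'⁻¹

theorem independentWeights_of_commute {a b : G} (ha : a ∈ D) (hb : b ∈ D) (hab : Commute a b)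
    (hD : ∀ d ∈ D, ∃ m n : ℤ, d = a ^ m * b ^ n) (hae : Commute a e) (hbe : Commute b e') :
    IndependentWeights D e e' := by
  intro d hd d' hd'
  obtain ⟨m, n, rfl⟩ := hD d hd
  obtain ⟨m', n', rfl⟩ := hD d' hd'
  have h (k : ℤ) : a ^ k * e * (a ^ k)⁻¹ = e := by
    rw [(hae.zpow_left k).eq, mul_inv_cancel_right]
  have h' (k : ℤ) : b ^ k * e' * (b ^ k)⁻¹ = e' := by
    rw [(hbe.zpow_left k).eq, mul_inv_cancel_right]
  have conj (x y g : G) : x * y * g * (x * y)⁻¹ = x * (y * g * y⁻¹) * x⁻¹ := by group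
  refine ⟨a ^ m' * b ^ n, mul_mem (zpow_mem ha _) (zpow_mem hb _), ?_, ?_⟩
  · rw [(hab.zpow_zpow m' n).eq, (hab.zpow_zpow m n).eq, conj, conj, h, h]
  · rw [conj, conj, h', h']

theorem IndependentWeights.commutator_conjClosure_le (h : IndependentWeights D e e')
    {W : Subgroup G} (hD : D ≤ normalizer (W : Set G)) (hmem : ⁅e, e'⁆ ∈ W)
    (he : conjClosure D e ≤ normalizer (W : Set G))
    (he' : conjClosure D e' ≤ normalizer (W : Set G)) :
    ⁅conjClosure D e, conjClosure D e'⁆ ≤ W := by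
  refine commutator_closure_le he he' ?_
  rintro _ ⟨d, hd, rfl⟩ _ ⟨d', hd', rfl⟩
  obtain ⟨c, hc, h1, h2⟩ := h d hd d' hd'
  rw [← h1, ← h2, ← conjugate_commutatorElement]
  exact le_normalizer_iff.1 hD c hc _ hmem

theorem IndependentWeights.commutator_conjClosure_eq_bot (h : IndependentWeights D e e')
    (hc : Commute e e') : ⁅conjClosure D e, conjClosure D e'⁆ = ⊥ := by
  have key (K : Subgroup G) : K ≤ normalizer ((⊥ : Subgroup G) : Set G) := le_normalizer_of_normal
  exact le_bot_iff.1 <| h.commutator_conjClosure_le (key _) (mem_bot.2 hc.commutator_eq)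
    (key _) (key _)

theorem exists_zpow_inv_mul_zpow {δ a : G}
    (hD : ∀ d ∈ D, ∃ m n : ℤ, d = δ ^ m * a ^ n) :
    ∀ d ∈ D, ∃ m n : ℤ, d = δ⁻¹ ^ m * a ^ n := by
  intro d hd
  obtain ⟨m, n, rfl⟩ := hD d hd
  exact ⟨-m, n, by simp⟩

/-- When `δ` raises `e` to the power `p`, the conjugates of `e` under the torus form a directed
family of cyclic groups. The exponent `N` may be any large enough number, so that finitely many
elements can be treated with the same `N`. -/
theorem exists_of_mem_conjClosure {p : ℕ} {δ a : G} (hδ : δ * e * δ⁻¹ = e ^ p)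
    (hD : ∀ d ∈ D, ∃ m n : ℤ, d = δ ^ m * a ^ n) (ha : Commute a e) {x : G}
    (hx : x ∈ conjClosure D e) :
    ∃ n : ℕ, ∀ N ≥ n, ∃ k : ℤ, x = (δ ^ N)⁻¹ * e ^ k * δ ^ N := by
  have hpow (n : ℕ) : δ ^ n * e * (δ ^ n)⁻¹ = e ^ p ^ n := by
    induction n with
    | zero => simp
    | succ n ih =>
      calc δ ^ (n + 1) * e * (δ ^ (n + 1))⁻¹ = δ ^ n * (δ * e * δ⁻¹) * (δ ^ n)⁻¹ := by
            rw [pow_succ]; group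
        _ = e ^ p ^ (n + 1) := by rw [hδ, ← conj_pow, ih, ← pow_mul, pow_succ]
  induction hx using closure_induction with
  | mem x hx =>
    obtain ⟨d, hd, rfl⟩ := hx
    obtain ⟨m, n, rfl⟩ := hD d hd
    refine ⟨(-m).toNat, fun N hN ↦ ⟨(p ^ (N + m).toNat : ℕ), ?_⟩⟩
    have h1 : δ ^ m = (δ ^ N)⁻¹ * δ ^ (N + m).toNat := by
      rw [← zpow_natCast, ← zpow_natCast, ← zpow_neg, ← zpow_add, Int.toNat_of_nonneg (by omega)]
      congr 1
      omega
    have h2 : a ^ n * e * (a ^ n)⁻¹ = e := by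
      rw [(ha.zpow_left n).eq, mul_inv_cancel_right]
    calc δ ^ m * a ^ n * e * (δ ^ m * a ^ n)⁻¹ = δ ^ m * (a ^ n * e * (a ^ n)⁻¹) * (δ ^ m)⁻¹ := by
          group
      _ = (δ ^ N)⁻¹ * (δ ^ (N + m).toNat * e * (δ ^ (N + m).toNat)⁻¹) * δ ^ N := by
          rw [h2, h1]; simp only [mul_inv_rev, inv_inv, mul_assoc]
      _ = _ := by rw [hpow, zpow_natCast]
  | one => exact ⟨0, fun N _ ↦ ⟨0, by simp⟩⟩
  | mul x y _ _ ihx ihy =>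
    obtain ⟨n, hn⟩ := ihx
    obtain ⟨m, hm⟩ := ihy
    refine ⟨max n m, fun N hN ↦ ?_⟩
    obtain ⟨k, hk⟩ := hn N (le_of_max_le_left hN)
    obtain ⟨l, hl⟩ := hm N (le_of_max_le_right hN)
    exact ⟨k + l, by rw [hk, hl, zpow_add]; group⟩
  | inv x _ ih =>
    obtain ⟨n, hn⟩ := ih
    refine ⟨n, fun N hN ↦ ?_⟩
    obtain ⟨k, hk⟩ := hn N hN
    exact ⟨-k, by rw [hk]; group⟩

theorem commutator_conjClosure_eq_bot_of_same_weight {p : ℕ} {δ a : G}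
    (hδ : δ * e * δ⁻¹ = e ^ p) (hδ' : δ * e' * δ⁻¹ = e' ^ p)
    (hD : ∀ d ∈ D, ∃ m n : ℤ, d = δ ^ m * a ^ n) (ha : Commute a e) (ha' : Commute a e')
    (hc : Commute e e') : ⁅conjClosure D e, conjClosure D e'⁆ = ⊥ := by
  refine commutator_eq_bot_of_commute fun x hx y hy ↦ ?_
  obtain ⟨n, hn⟩ := exists_of_mem_conjClosure hδ hD ha hx
  obtain ⟨m, hm⟩ := exists_of_mem_conjClosure hδ' hD ha' hy
  obtain ⟨k, rfl⟩ := hn _ (le_max_left n m)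
  obtain ⟨l, rfl⟩ := hm _ (le_max_right n m)
  have h := (Commute.conj_iff (δ ^ max n m)⁻¹).2 (hc.zpow_zpow k l)
  rwa [inv_inv] at h

end Subgroup

/-! ### The relations in the presented group -/

namespace AbelsPresented

open AbelsGen Subgroup

variable (p s : ℕ)

/-- The class of `d₂`. -/
def d₂ : AbelsPresented p s := PresentedGroup.of AbelsGen.d₂

/-- The class of `d₃`. -/
def d₃ : AbelsPresented p s := PresentedGroup.of AbelsGen.d₃

/-- The class of `e_{ij}` with indices from `0`, extended by the value `1` to the pairs `(i, j)` for
which there is no such generator. -/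
def e (i j : Fin 5) : AbelsPresented p s :=
  if h : i < j ∧ i.val < s then PresentedGroup.of (AbelsGen.e i j h) else 1

variable {p s}

theorem e_of {i j : Fin 5} (h : i < j ∧ i.val < s) :
    e p s i j = PresentedGroup.of (AbelsGen.e i j h) := dif_pos h

theorem mk_E {i j : Fin 5} (h : i < j ∧ i.val < s) :
    PresentedGroup.mk {r | AbelsRelator p s r} (E i j h) = e p s i j := (e_of h).symm

theorem mk_eq_one {r : FreeGroup (AbelsGen s)} (h : AbelsRelator p s r) :
    PresentedGroup.mk {r | AbelsRelator p s r} r = 1 := PresentedGroup.one_of_mem h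

theorem commute_d₂_d₃ : Commute (d₂ p s) (d₃ p s) := by
  have := mk_eq_one (p := p) (s := s) .d₂_d₃
  rwa [map_commutatorElement, commutatorElement_eq_one_iff_commute] at this

theorem d₂_row (j : Fin 5) (h : 1 < j) (hs : 1 < s) :
    d₂ p s * e p s 1 j * (d₂ p s)⁻¹ = e p s 1 j ^ p := by
  have := mk_eq_one (p := p) (.d₂_row j ⟨h, hs⟩)
  rwa [map_mul, map_inv, mul_inv_eq_one, map_pow, map_mul, map_mul, map_inv, mk_E] at this

theorem d₂_col (hs : 0 < s) : (d₂ p s)⁻¹ * e p s 0 1 * d₂ p s = e p s 0 1 ^ p := by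
  have := mk_eq_one (p := p) (.d₂_col 0 ⟨by decide, hs⟩)
  rwa [map_mul, map_inv, mul_inv_eq_one, map_pow, map_mul, map_mul, map_inv, mk_E] at this

theorem d₂_comm (i j : Fin 5) (hi : i ≠ 1) (hj : j ≠ 1) : Commute (d₂ p s) (e p s i j) := by
  by_cases h : i < j ∧ i.val < s
  · have := mk_eq_one (p := p) (.d₂_comm i j h hi hj)
    rwa [map_commutatorElement, commutatorElement_eq_one_iff_commute, mk_E] at this
  · rw [e, dif_neg h]
    exact Commute.one_right _

theorem d₃_row (j : Fin 5) (h : 2 < j) (hs : 2 < s) :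
    d₃ p s * e p s 2 j * (d₃ p s)⁻¹ = e p s 2 j ^ p := by
  have := mk_eq_one (p := p) (.d₃_row j ⟨h, hs⟩)
  rwa [map_mul, map_inv, mul_inv_eq_one, map_pow, map_mul, map_mul, map_inv, mk_E] at this

theorem d₃_col (i : Fin 5) (h : i < 2) (hs : i.val < s) :
    (d₃ p s)⁻¹ * e p s i 2 * d₃ p s = e p s i 2 ^ p := by
  have := mk_eq_one (p := p) (.d₃_col i ⟨h, hs⟩)
  rwa [map_mul, map_inv, mul_inv_eq_one, map_pow, map_mul, map_mul, map_inv, mk_E] at this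

theorem d₃_comm (i j : Fin 5) (hi : i ≠ 2) (hj : j ≠ 2) : Commute (d₃ p s) (e p s i j) := by
  by_cases h : i < j ∧ i.val < s
  · have := mk_eq_one (p := p) (.d₃_comm i j h hi hj)
    rwa [map_commutatorElement, commutatorElement_eq_one_iff_commute, mk_E] at this
  · rw [e, dif_neg h]
    exact Commute.one_right _

theorem e_comm (i j k l : Fin 5) (hik : i ≤ k) (hjk : j ≠ k) :
    Commute (e p s i j) (e p s k l) := by
  by_cases h : i < j ∧ i.val < s
  · by_cases h' : k < l ∧ k.val < s
    · have := mk_eq_one (p := p) (.e_comm i j k l h h' hik hjk)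
      rwa [map_commutatorElement, commutatorElement_eq_one_iff_commute, mk_E, mk_E] at this
    · rw [e, e, dif_neg h']
      exact Commute.one_right _
  · rw [e, dif_neg h]
    exact Commute.one_left _

theorem e_mul (i j l : Fin 5) (hij : i < j) (hjl : j < l) (hj : j.val < s) :
    ⁅e p s i j, e p s j l⁆ = e p s i l := by
  have hi : i.val < s := lt_trans hij hj
  have := mk_eq_one (p := p) (.e_mul i j l ⟨hij, hi⟩ ⟨hjl, hj⟩ ⟨hij.trans hjl, hi⟩)
  rwa [map_mul, map_inv, mul_inv_eq_one, map_commutatorElement, mk_E, mk_E, mk_E] at this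

theorem closure_generators {H : Subgroup (AbelsPresented p s)} (h₂ : d₂ p s ∈ H)
    (h₃ : d₃ p s ∈ H) (he : ∀ i j, i < j ∧ i.val < s → e p s i j ∈ H) : H = ⊤ := by
  rw [← top_le_iff, ← PresentedGroup.closure_range_of, Subgroup.closure_le]
  rintro _ ⟨_ | _ | ⟨i, j, h⟩, rfl⟩
  · exact h₂
  · exact h₃
  · exact e_of (p := p) h ▸ he i j h

/-! ### Root subgroups of the presented group with three rows -/

variable (p)

/-- The subgroup generated by `d₂` and `d₃`. -/
def torus : Subgroup (AbelsPresented p 3) := Subgroup.closure {d₂ p 3, d₃ p 3}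

/-- The subgroup generated by the conjugates of `e_{ij}` under the torus. It is the full root
subgroup, except for `(i, j) = (0, 3), (0, 4)`, where the torus centralises `e_{ij}`. -/
def root (i j : Fin 5) : Subgroup (AbelsPresented p 3) := (torus p).conjClosure (e p 3 i j)

/-- The root subgroups at the positions `(0, 3)` and `(0, 4)`. -/
def centralRoot (c : Fin 5) : Subgroup (AbelsPresented p 3) := ⁅root p 0 1, root p 1 c⁆

variable {p}

theorem d₂_mem_torus : d₂ p 3 ∈ torus p := Subgroup.subset_closure (by simp)

theorem d₃_mem_torus : d₃ p 3 ∈ torus p := Subgroup.subset_closure (by simp)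

theorem exists_of_mem_torus {a b : AbelsPresented p 3} (hab : Commute a b)
    (h₂ : d₂ p 3 ∈ Subgroup.closure {a, b}) (h₃ : d₃ p 3 ∈ Subgroup.closure {a, b}) :
    ∀ d ∈ torus p, ∃ m n : ℤ, d = a ^ m * b ^ n := by
  intro d hd
  replace hd : d ∈ Subgroup.closure {a, b} :=
    (Subgroup.closure_le _).2 (by rintro _ (rfl | rfl) <;> assumption) hd
  induction hd using Subgroup.closure_induction with
  | mem x hx =>
    rcases hx with rfl | rfl
    · exact ⟨1, 0, by simp⟩
    · exact ⟨0, 1, by simp⟩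
  | one => exact ⟨0, 0, by simp⟩
  | mul x y _ _ ihx ihy =>
    obtain ⟨m, n, rfl⟩ := ihx
    obtain ⟨k, l, rfl⟩ := ihy
    refine ⟨m + k, n + l, ?_⟩
    rw [zpow_add, zpow_add, mul_assoc, ← mul_assoc (b ^ n), ← (hab.zpow_zpow k n).eq]
    simp only [mul_assoc]
  | inv x _ ih =>
    obtain ⟨m, n, rfl⟩ := ih
    exact ⟨-m, -n, by rw [mul_inv_rev, ← zpow_neg, ← zpow_neg, ← (hab.zpow_zpow _ _).eq]⟩

theorem torus_d₂_d₃ : ∀ d ∈ torus p, ∃ m n : ℤ, d = d₂ p 3 ^ m * d₃ p 3 ^ n :=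
  exists_of_mem_torus commute_d₂_d₃ (left_mem_closure_pair _ _) (right_mem_closure_pair _ _)

theorem torus_d₃_d₂ : ∀ d ∈ torus p, ∃ m n : ℤ, d = d₃ p 3 ^ m * d₂ p 3 ^ n :=
  exists_of_mem_torus commute_d₂_d₃.symm (right_mem_closure_pair _ _) (left_mem_closure_pair _ _)

theorem commute_d₂_d₂d₃ : Commute (d₂ p 3) (d₂ p 3 * d₃ p 3) :=
  (Commute.refl _).mul_right commute_d₂_d₃

theorem commute_d₃_d₂d₃ : Commute (d₃ p 3) (d₂ p 3 * d₃ p 3) :=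
  commute_d₂_d₃.symm.mul_right (Commute.refl _)

theorem torus_d₂_d₂d₃ : ∀ d ∈ torus p, ∃ m n : ℤ, d = d₂ p 3 ^ m * (d₂ p 3 * d₃ p 3) ^ n := by
  refine exists_of_mem_torus commute_d₂_d₂d₃ (left_mem_closure_pair _ _) ?_
  simpa using mul_mem (inv_mem (left_mem_closure_pair (d₂ p 3) (d₂ p 3 * d₃ p 3)))
    (right_mem_closure_pair (d₂ p 3) (d₂ p 3 * d₃ p 3))

theorem torus_d₃_d₂d₃ : ∀ d ∈ torus p, ∃ m n : ℤ, d = d₃ p 3 ^ m * (d₂ p 3 * d₃ p 3) ^ n := by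
  refine exists_of_mem_torus commute_d₃_d₂d₃ ?_ (left_mem_closure_pair _ _)
  simpa using mul_mem (right_mem_closure_pair (d₃ p 3) (d₂ p 3 * d₃ p 3))
    (inv_mem (left_mem_closure_pair (d₃ p 3) (d₂ p 3 * d₃ p 3)))

theorem d₂d₃_mem_torus : d₂ p 3 * d₃ p 3 ∈ torus p := mul_mem d₂_mem_torus d₃_mem_torus

theorem d₂d₃_comm : Commute (d₂ p 3 * d₃ p 3) (e p 3 1 2) := by
  have h2 := d₂_row (p := p) (s := 3) 2 (by decide) (by decide)
  have h3 := d₃_col (p := p) (s := 3) 1 (by decide) (by decide)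
  rw [commute_d₂_d₃.eq, Commute, SemiconjBy, ← mul_inv_eq_iff_eq_mul, mul_inv_rev]
  calc _ = d₃ p 3 * (d₂ p 3 * e p 3 1 2 * (d₂ p 3)⁻¹) * (d₃ p 3)⁻¹ := by group
    _ = _ := by rw [h2, ← h3]; group

/-! With indices from `0` and `c > 2`, the torus acts on `e_{01}` and `e_{1c}` through `d₂`, on
`e_{02}` and `e_{2c}` through `d₃`, and on `e_{12}` through the quotient by `d₂ d₃`, so that
elements of different classes have independent weights. -/

theorem independent_d₂_d₃ {x y : AbelsPresented p 3} (hx : Commute (d₃ p 3) x)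
    (hy : Commute (d₂ p 3) y) : IndependentWeights (torus p) x y :=
  independentWeights_of_commute d₃_mem_torus d₂_mem_torus commute_d₂_d₃.symm torus_d₃_d₂ hx hy

theorem independent_d₂_d₂d₃ {x y : AbelsPresented p 3} (hx : Commute (d₃ p 3) x)
    (hy : Commute (d₂ p 3 * d₃ p 3) y) : IndependentWeights (torus p) x y :=
  independentWeights_of_commute d₃_mem_torus d₂d₃_mem_torus commute_d₃_d₂d₃ torus_d₃_d₂d₃ hx hy

theorem independent_d₃_d₂d₃ {x y : AbelsPresented p 3} (hx : Commute (d₂ p 3) x)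
    (hy : Commute (d₂ p 3 * d₃ p 3) y) : IndependentWeights (torus p) x y :=
  independentWeights_of_commute d₂_mem_torus d₂d₃_mem_torus commute_d₂_d₂d₃ torus_d₂_d₂d₃ hx hy

theorem ne_of_two_lt {c : Fin 5} (hc : 2 < c) : c ≠ 0 ∧ c ≠ 1 ∧ c ≠ 2 := by omega

theorem d₃_comm_e₁ {c : Fin 5} (hc : 2 < c) : Commute (d₃ p 3) (e p 3 1 c) :=
  d₃_comm _ _ (by decide) (ne_of_two_lt hc).2.2

theorem d₂_comm_e₂ {c : Fin 5} (hc : 2 < c) : Commute (d₂ p 3) (e p 3 2 c) :=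
  d₂_comm _ _ (by decide) (ne_of_two_lt hc).2.1

theorem commutator_root_01_02 : ⁅root p 0 1, root p 0 2⁆ = ⊥ :=
  (independent_d₂_d₃ (d₃_comm _ _ (by decide) (by decide))
    (d₂_comm _ _ (by decide) (by decide))).commutator_conjClosure_eq_bot
    (e_comm _ _ _ _ (by decide) (by decide))

theorem commutator_root_01_2 {c : Fin 5} (hc : 2 < c) : ⁅root p 0 1, root p 2 c⁆ = ⊥ :=
  (independent_d₂_d₃ (d₃_comm _ _ (by decide) (by decide))
    (d₂_comm_e₂ hc)).commutator_conjClosure_eq_bot (e_comm _ _ _ _ (by decide) (by decide))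

theorem commutator_root_02_12 : ⁅root p 0 2, root p 1 2⁆ = ⊥ :=
  (independent_d₃_d₂d₃ (d₂_comm _ _ (by decide) (by decide))
    d₂d₃_comm).commutator_conjClosure_eq_bot (e_comm _ _ _ _ (by decide) (by decide))

theorem commutator_root_1_02 {c : Fin 5} (hc : 2 < c) : ⁅root p 1 c, root p 0 2⁆ = ⊥ :=
  (independent_d₂_d₃ (d₃_comm_e₁ hc)
    (d₂_comm _ _ (by decide) (by decide))).commutator_conjClosure_eq_bot
    (e_comm _ _ _ _ (by decide) (by decide)).symm

theorem commutator_root_1_12 {c : Fin 5} (hc : 2 < c) : ⁅root p 1 c, root p 1 2⁆ = ⊥ :=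
  (independent_d₂_d₂d₃ (d₃_comm_e₁ hc) d₂d₃_comm).commutator_conjClosure_eq_bot
    (e_comm _ _ _ _ (by decide) (by decide)).symm

theorem commutator_root_1_2 {c c' : Fin 5} (hc : 2 < c) (hc' : 2 < c') :
    ⁅root p 1 c, root p 2 c'⁆ = ⊥ :=
  (independent_d₂_d₃ (d₃_comm_e₁ hc) (d₂_comm_e₂ hc')).commutator_conjClosure_eq_bot
    (e_comm _ _ _ _ (by decide) (ne_of_two_lt hc).2.2)

theorem commutator_root_1_1 {c c' : Fin 5} (hc : 2 < c) (hc' : 2 < c') :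
    ⁅root p 1 c, root p 1 c'⁆ = ⊥ :=
  commutator_conjClosure_eq_bot_of_same_weight
    (d₂_row _ (by omega) (by decide)) (d₂_row _ (by omega) (by decide)) torus_d₂_d₃
    (d₃_comm_e₁ hc) (d₃_comm_e₁ hc') (e_comm _ _ _ _ le_rfl (ne_of_two_lt hc).2.1)

theorem commutator_root_2_2 {c c' : Fin 5} (hc : 2 < c) (hc' : 2 < c') :
    ⁅root p 2 c, root p 2 c'⁆ = ⊥ :=
  commutator_conjClosure_eq_bot_of_same_weight
    (d₃_row _ hc (by decide)) (d₃_row _ hc' (by decide)) torus_d₃_d₂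
    (d₂_comm_e₂ hc) (d₂_comm_e₂ hc') (e_comm _ _ _ _ le_rfl (ne_of_two_lt hc).2.2)

theorem commutator_root_01_12 : ⁅root p 0 1, root p 1 2⁆ ≤ root p 0 2 := by
  refine (independent_d₂_d₂d₃ (d₃_comm _ _ (by decide) (by decide))
    d₂d₃_comm).commutator_conjClosure_le le_normalizer_conjClosure ?_
    (le_normalizer_of_commutator_eq_bot commutator_root_01_02)
    (le_normalizer_of_commutator_eq_bot ((commutator_comm _ _).trans commutator_root_02_12))
  rw [e_mul _ _ _ (by decide) (by decide) (by decide)]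
  exact self_mem_conjClosure

theorem commutator_root_2_12 {c : Fin 5} (hc : 2 < c) : ⁅root p 2 c, root p 1 2⁆ ≤ root p 1 c := by
  refine (independent_d₃_d₂d₃ (d₂_comm_e₂ hc)
    d₂d₃_comm).commutator_conjClosure_le le_normalizer_conjClosure ?_
    (le_normalizer_of_commutator_eq_bot
      ((commutator_comm _ _).trans (commutator_root_1_2 hc hc)))
    (le_normalizer_of_commutator_eq_bot ((commutator_comm _ _).trans (commutator_root_1_12 hc)))
  rw [← commutatorElement_inv, e_mul _ _ _ (by decide) hc (by decide)]
  exact inv_mem self_mem_conjClosure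

/-! ### The central root subgroups -/

theorem root_commutator_assoc {c : Fin 5} (hc : 2 < c) {x y z : AbelsPresented p 3}
    (hx : x ∈ root p 0 1) (hy : y ∈ root p 1 2) (hz : z ∈ root p 2 c) :
    ⁅x, ⁅y, z⁆⁆ = ⁅⁅x, y⁆, z⁆ := by
  have h1 : ⁅y, z⁆ ∈ root p 1 c := by
    rw [← commutatorElement_inv]
    exact inv_mem (commutator_root_2_12 hc (commutator_mem_commutator hz hy))
  have h2 := commutator_root_01_12 (commutator_mem_commutator hx hy)
  exact commutatorElement_assoc (commute_of_commutator_eq_bot (commutator_root_01_2 hc) hx hz)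
    (commute_of_commutator_eq_bot (commutator_root_1_02 hc) h1 h2)
    (commute_of_commutator_eq_bot (commutator_root_1_2 hc hc) h1 hz)

/-- The generators of `root p 1 c` are commutators `⁅y, z⁆`, those of `root p 0 2` are commutators
`⁅x, y⁆`, and `⁅x, ⁅y, z⁆⁆ = ⁅⁅x, y⁆, z⁆`. -/
theorem centralRoot_eq {c : Fin 5} (hc : 2 < c) :
    centralRoot p c = ⁅root p 0 2, root p 2 c⁆ := by
  refine le_antisymm ?_ ?_
  · refine commutator_closure_le ?_ ?_ ?_
    · exact le_normalizer_commutator_of_commute commutator_root_01_02 (commutator_root_01_2 hc)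
    · exact le_normalizer_commutator_of_commute (commutator_root_1_02 hc)
        (commutator_root_1_2 hc hc)
    · rintro x ⟨d, hd, rfl⟩ y ⟨d', hd', rfl⟩
      rw [← e_mul 1 2 c (by decide) hc (by decide), conjugate_commutatorElement (g₃ := d'),
        root_commutator_assoc hc (conj_mem_conjClosure hd) (conj_mem_conjClosure hd')
          (conj_mem_conjClosure hd')]
      exact commutator_mem_commutator (commutator_root_01_12 (commutator_mem_commutator
        (conj_mem_conjClosure hd) (conj_mem_conjClosure hd'))) (conj_mem_conjClosure hd')
  · refine commutator_closure_le ?_ ?_ ?_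
    · exact le_normalizer_commutator_of_commute ((commutator_comm _ _).trans commutator_root_01_02)
        ((commutator_comm _ _).trans (commutator_root_1_02 hc))
    · exact le_normalizer_commutator_of_commute
        ((commutator_comm _ _).trans (commutator_root_01_2 hc))
        ((commutator_comm _ _).trans (commutator_root_1_2 hc hc))
    · rintro x ⟨d, hd, rfl⟩ y ⟨d', hd', rfl⟩
      rw [← e_mul 0 1 2 (by decide) (by decide) (by decide), conjugate_commutatorElement (g₃ := d),
        ← root_commutator_assoc hc (conj_mem_conjClosure hd) (conj_mem_conjClosure hd)
          (conj_mem_conjClosure hd')]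
      refine commutator_mem_commutator (conj_mem_conjClosure hd) ?_
      rw [← commutatorElement_inv]
      exact inv_mem (commutator_root_2_12 hc (commutator_mem_commutator
        (conj_mem_conjClosure hd') (conj_mem_conjClosure hd)))

theorem commutator_root_01_centralRoot {c : Fin 5} (hc : 2 < c) :
    ⁅root p 0 1, centralRoot p c⁆ = ⊥ :=
  centralRoot_eq hc ▸ commutator_commutator_eq_bot commutator_root_01_02 (commutator_root_01_2 hc)

theorem commutator_root_02_centralRoot {c : Fin 5} (hc : 2 < c) :
    ⁅root p 0 2, centralRoot p c⁆ = ⊥ :=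
  commutator_commutator_eq_bot ((commutator_comm _ _).trans commutator_root_01_02)
    ((commutator_comm _ _).trans (commutator_root_1_02 hc))

theorem commutator_root_1_centralRoot {c c' : Fin 5} (hc : 2 < c) (hc' : 2 < c') :
    ⁅root p 1 c, centralRoot p c'⁆ = ⊥ :=
  centralRoot_eq hc' ▸ commutator_commutator_eq_bot (commutator_root_1_02 hc)
    (commutator_root_1_2 hc hc')

theorem commutator_root_2_centralRoot {c c' : Fin 5} (hc : 2 < c) (hc' : 2 < c') :
    ⁅root p 2 c, centralRoot p c'⁆ = ⊥ :=
  commutator_commutator_eq_bot ((commutator_comm _ _).trans (commutator_root_01_2 hc))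
    ((commutator_comm _ _).trans (commutator_root_1_2 hc' hc))

theorem commutator_centralRoot_centralRoot {c c' : Fin 5} (hc : 2 < c) (hc' : 2 < c') :
    ⁅centralRoot p c, centralRoot p c'⁆ = ⊥ :=
  commutator_commutator_eq_bot
    ((commutator_comm _ _).trans (commutator_root_01_centralRoot hc))
    ((commutator_comm _ _).trans (commutator_root_1_centralRoot hc' hc))

/-- An element `y` of `root p 1 2` moves `x` in `root p 0 1` by the element `⁅y, x⁆` of
`root p 0 2`, which commutes with `root p 1 c`; so it fixes `⁅x, z⁆` for `z` in `root p 1 c`. -/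
theorem commutator_root_12_centralRoot {c : Fin 5} (hc : 2 < c) :
    ⁅root p 1 2, centralRoot p c⁆ = ⊥ := by
  rw [commutator_eq_bot_iff_le_centralizer, ← le_centralizer_iff, centralRoot, commutator_le]
  intro x hx z hz
  rw [mem_centralizer_iff]
  intro y hy
  have hyx : ⁅y, x⁆ ∈ root p 0 2 := by
    rw [← commutatorElement_inv]
    exact inv_mem (commutator_root_01_12 (commutator_mem_commutator hx hy))
  have hyz : Commute z y := commute_of_commutator_eq_bot (commutator_root_1_12 hc) hz hy
  have hzyx : Commute ⁅y, x⁆ z :=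
    (commute_of_commutator_eq_bot (commutator_root_1_02 hc) hz hyx).symm
  have hc' : Commute ⁅y, x⁆ ⁅x, z⁆ := commute_of_commutator_eq_bot
    (commutator_root_02_centralRoot hc) hyx (commutator_mem_commutator hx hz)
  have h : y * x * y⁻¹ = ⁅y, x⁆ * x := by simp [commutatorElement_def]
  rw [← mul_inv_eq_iff_eq_mul, conjugate_commutatorElement, h, ← hyz.eq, mul_inv_cancel_right,
    commutatorElement_mul_left_eq_conj_mul, hc'.eq, mul_inv_cancel_right, hzyx.commutator_eq,
    mul_one]

theorem commute_d₂_of_mem_torus {d : AbelsPresented p 3} (hd : d ∈ torus p) :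
    Commute d (d₂ p 3) := by
  obtain ⟨m, n, rfl⟩ := torus_d₂_d₃ d hd
  exact ((Commute.refl _).zpow_left m).mul_left (commute_d₂_d₃.symm.zpow_left n)

/-- As `⁅x, e_{1c}⁆ = ⁅⁅x, e_{12}⁆, e_{2c}⁆` has both entries fixed by `d₂`. -/
theorem commute_d₂_commutator {c : Fin 5} (hc : 2 < c) {x : AbelsPresented p 3}
    (hx : x ∈ root p 0 1) : Commute (d₂ p 3) ⁅x, e p 3 1 c⁆ := by
  have h12 : e p 3 1 2 ∈ root p 1 2 := self_mem_conjClosure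
  rw [← e_mul 1 2 c (by decide) hc (by decide), root_commutator_assoc hc hx h12
    self_mem_conjClosure]
  have h2 : Commute (d₂ p 3) ⁅x, e p 3 1 2⁆ :=
    commute_of_mem_conjClosure (fun _ ↦ commute_d₂_of_mem_torus)
      (d₂_comm _ _ (by decide) (by decide))
      (commutator_root_01_12 (commutator_mem_commutator hx h12))
  have h3 := d₂_comm_e₂ (p := p) hc
  rw [commutatorElement_def ⁅x, _⁆]
  exact ((h2.mul_right h3).mul_right h2.inv_right).mul_right h3.inv_right

/-- For every `c > 2`, the map `x ↦ ⁅x, e_{1c}⁆` is a homomorphism from `root p 0 1` to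
`centralRoot p c`. It is onto since `d₂` shifts any conjugate of `e_{1c}` to `e_{1c}` itself while
fixing the commutator. -/
theorem exists_of_mem_centralRoot {c : Fin 5} (hc : 2 < c) {v : AbelsPresented p 3}
    (hv : v ∈ centralRoot p c) : ∃ x ∈ root p 0 1, v = ⁅x, e p 3 1 c⁆ := by
  have hy : e p 3 1 c ∈ root p 1 c := self_mem_conjClosure
  have hcomm {x y : AbelsPresented p 3} (hx : x ∈ root p 0 1) (hy' : y ∈ root p 0 1) :
      Commute x ⁅y, e p 3 1 c⁆ := commute_of_commutator_eq_bot
    (commutator_root_01_centralRoot hc) hx (commutator_mem_commutator hy' hy)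
  let T : Subgroup (AbelsPresented p 3) :=
    { carrier := {v | ∃ x ∈ root p 0 1, v = ⁅x, e p 3 1 c⁆}
      one_mem' := ⟨1, one_mem _, by simp⟩
      mul_mem' := by
        rintro _ _ ⟨x, hx, rfl⟩ ⟨y, hy, rfl⟩
        refine ⟨y * x, mul_mem hy hx, ?_⟩
        rw [commutatorElement_mul_left_eq_conj_mul, (hcomm hy hx).eq, mul_inv_cancel_right]
      inv_mem' := by
        rintro _ ⟨x, hx, rfl⟩
        refine ⟨x⁻¹, inv_mem hx, ?_⟩
        rw [commutatorElement_inv_left, ← commutatorElement_inv x, mul_assoc,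
          ← (hcomm hx hx).inv_right.eq, inv_mul_cancel_left] }
  have hT : T ≤ centralRoot p c := by
    rintro _ ⟨x, hx, rfl⟩
    exact commutator_mem_commutator hx hy
  have hle : centralRoot p c ≤ T := by
    refine commutator_closure_le ?_ ?_ ?_
    · exact le_normalizer_of_commutator_eq_bot <| le_bot_iff.1 <|
        (commutator_mono le_rfl hT).trans (commutator_root_01_centralRoot hc).le
    · exact le_normalizer_of_commutator_eq_bot <| le_bot_iff.1 <|
        (commutator_mono le_rfl hT).trans (commutator_root_1_centralRoot hc hc).le
    · rintro _ ⟨d, hd, rfl⟩ _ ⟨d', hd', rfl⟩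
      obtain ⟨m, n, rfl⟩ := torus_d₂_d₃ d' hd'
      have h3 : d₂ p 3 ^ m * d₃ p 3 ^ n * e p 3 1 c * (d₂ p 3 ^ m * d₃ p 3 ^ n)⁻¹ =
          d₂ p 3 ^ m * e p 3 1 c * (d₂ p 3 ^ m)⁻¹ := by
        rw [mul_assoc (d₂ p 3 ^ m), ((d₃_comm_e₁ hc).zpow_left n).eq]
        group
      have hx : (d₂ p 3 ^ m)⁻¹ * (d * e p 3 0 1 * d⁻¹) * d₂ p 3 ^ m ∈ root p 0 1 := by
        simpa [root, mul_assoc] using conj_mem_conjClosure (e := e p 3 0 1)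
          (mul_mem (inv_mem (zpow_mem d₂_mem_torus m)) hd)
      refine ⟨_, hx, ?_⟩
      rw [h3, ← mul_inv_cancel_right ⁅(d₂ p 3 ^ m)⁻¹ * _ * _, _⁆ (d₂ p 3 ^ m),
        ← ((commute_d₂_commutator hc hx).zpow_left m).eq, conjugate_commutatorElement]
      congr 1
      group
  exact hle hv

/-! ### The normal form -/

variable (p) in
/-- The unipotent elements that differ from `1` in the row with index `2` only. -/
def row₂ : Subgroup (AbelsPresented p 3) := root p 2 3 ⊔ root p 2 4

variable (p) in
/-- The unipotent elements that differ from `1` in the row with index `1` only. -/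
def row₁ : Subgroup (AbelsPresented p 3) := root p 1 2 ⊔ (root p 1 3 ⊔ root p 1 4)

variable (p) in
/-- The unipotent elements that differ from `1` in the row with index `0` only. -/
def row₀ : Subgroup (AbelsPresented p 3) :=
  root p 0 1 ⊔ (root p 0 2 ⊔ (centralRoot p 3 ⊔ centralRoot p 4))

theorem two_lt_three : (2 : Fin 5) < 3 := by decide

theorem two_lt_four : (2 : Fin 5) < 4 := by decide

theorem root_1_le_row₁ {c : Fin 5} (hc : 2 < c) : root p 1 c ≤ row₁ p := by
  obtain rfl | rfl : c = 3 ∨ c = 4 := by omega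
  · exact le_sup_left.trans le_sup_right
  · exact le_sup_right.trans le_sup_right

theorem root_01_le_row₀ : root p 0 1 ≤ row₀ p := le_sup_left

theorem root_02_le_row₀ : root p 0 2 ≤ row₀ p := le_sup_left.trans le_sup_right

theorem centralRoot_le_row₀ {c : Fin 5} (hc : 2 < c) : centralRoot p c ≤ row₀ p := by
  obtain rfl | rfl : c = 3 ∨ c = 4 := by omega
  · exact le_sup_left.trans (le_sup_right.trans le_sup_right)
  · exact le_sup_right.trans (le_sup_right.trans le_sup_right)

theorem torus_le_normalizer_centralRoot (c : Fin 5) :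
    torus p ≤ normalizer (centralRoot p c : Set (AbelsPresented p 3)) :=
  le_normalizer_commutator le_normalizer_conjClosure le_normalizer_conjClosure

theorem torus_le_normalizer_row₂ : torus p ≤ normalizer (row₂ p : Set (AbelsPresented p 3)) :=
  le_normalizer_sup le_normalizer_conjClosure le_normalizer_conjClosure

theorem torus_le_normalizer_row₁ : torus p ≤ normalizer (row₁ p : Set (AbelsPresented p 3)) :=
  le_normalizer_sup le_normalizer_conjClosure
    (le_normalizer_sup le_normalizer_conjClosure le_normalizer_conjClosure)

theorem torus_le_normalizer_row₀ : torus p ≤ normalizer (row₀ p : Set (AbelsPresented p 3)) :=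
  le_normalizer_sup le_normalizer_conjClosure (le_normalizer_sup le_normalizer_conjClosure
    (le_normalizer_sup (torus_le_normalizer_centralRoot 3) (torus_le_normalizer_centralRoot 4)))

theorem le_normalizer_row₀ {K : Subgroup (AbelsPresented p 3)}
    (h1 : ⁅K, root p 0 1⁆ ≤ row₀ p) (h2 : ⁅K, root p 0 2⁆ ≤ row₀ p)
    (h : ∀ c, 2 < c → ⁅K, centralRoot p c⁆ = ⊥) :
    K ≤ normalizer (row₀ p : Set (AbelsPresented p 3)) := by
  have hbot {c : Fin 5} (hc : 2 < c) : ⁅K, centralRoot p c⁆ ≤ row₀ p := (h c hc) ▸ bot_le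
  exact le_normalizer_iff_commutator_le_right.2 <|
    commutator_sup_le root_01_le_row₀ h1 le_sup_right <|
    commutator_sup_le root_02_le_row₀ h2 (le_sup_right.trans le_sup_right) <|
    commutator_sup_le (centralRoot_le_row₀ two_lt_three) (hbot two_lt_three)
      (centralRoot_le_row₀ two_lt_four) (hbot two_lt_four)

theorem root_2_le_normalizer_row₁ {c : Fin 5} (hc : 2 < c) :
    root p 2 c ≤ normalizer (row₁ p : Set (AbelsPresented p 3)) := by
  have h {c' : Fin 5} (hc' : 2 < c') :
    ⁅root p 2 c, root p 1 c'⁆ ≤ row₁ p :=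
    ((commutator_comm _ _).trans (commutator_root_1_2 hc' hc)) ▸ bot_le
  exact le_normalizer_iff_commutator_le_right.2 <|
    commutator_sup_le le_sup_left ((commutator_root_2_12 hc).trans (root_1_le_row₁ hc))
      le_sup_right <|
    commutator_sup_le (root_1_le_row₁ two_lt_three) (h two_lt_three)
      (root_1_le_row₁ two_lt_four) (h two_lt_four)

theorem root_2_le_normalizer_row₀ {c : Fin 5} (hc : 2 < c) :
    root p 2 c ≤ normalizer (row₀ p : Set (AbelsPresented p 3)) := by
  refine le_normalizer_row₀ ?_ ?_ fun c' hc' ↦ commutator_root_2_centralRoot hc hc'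
  · rw [commutator_comm, commutator_root_01_2 hc]
    exact bot_le
  · rw [commutator_comm, ← centralRoot_eq hc]
    exact centralRoot_le_row₀ hc

theorem root_1_le_normalizer_row₀ {c : Fin 5} (hc : 2 < c) :
    root p 1 c ≤ normalizer (row₀ p : Set (AbelsPresented p 3)) := by
  refine le_normalizer_row₀ ?_ ?_ fun c' hc' ↦ commutator_root_1_centralRoot hc hc'
  · rw [commutator_comm]
    exact centralRoot_le_row₀ hc
  · rw [commutator_root_1_02 hc]
    exact bot_le

theorem root_12_le_normalizer_row₀ :
    root p 1 2 ≤ normalizer (row₀ p : Set (AbelsPresented p 3)) := by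
  refine le_normalizer_row₀ ?_ ?_ fun c' hc' ↦ commutator_root_12_centralRoot hc'
  · rw [commutator_comm]
    exact commutator_root_01_12.trans root_02_le_row₀
  · rw [commutator_comm, commutator_root_02_12]
    exact bot_le

theorem row₂_le_normalizer_row₁ : row₂ p ≤ normalizer (row₁ p : Set (AbelsPresented p 3)) :=
  sup_le (root_2_le_normalizer_row₁ two_lt_three) (root_2_le_normalizer_row₁ two_lt_four)

theorem row₂_le_normalizer_row₀ : row₂ p ≤ normalizer (row₀ p : Set (AbelsPresented p 3)) :=
  sup_le (root_2_le_normalizer_row₀ two_lt_three) (root_2_le_normalizer_row₀ two_lt_four)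

theorem row₁_le_normalizer_row₀ : row₁ p ≤ normalizer (row₀ p : Set (AbelsPresented p 3)) :=
  sup_le root_12_le_normalizer_row₀
    (sup_le (root_1_le_normalizer_row₀ two_lt_three) (root_1_le_normalizer_row₀ two_lt_four))

theorem sup_rows_eq_top : ((torus p ⊔ row₂ p) ⊔ row₁ p) ⊔ row₀ p = ⊤ := by
  have hD : torus p ≤ ((torus p ⊔ row₂ p) ⊔ row₁ p) ⊔ row₀ p :=
    le_sup_left.trans (le_sup_left.trans le_sup_left)
  have h2 : row₂ p ≤ ((torus p ⊔ row₂ p) ⊔ row₁ p) ⊔ row₀ p :=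
    le_sup_right.trans (le_sup_left.trans le_sup_left)
  have h1 : row₁ p ≤ ((torus p ⊔ row₂ p) ⊔ row₁ p) ⊔ row₀ p :=
    le_sup_right.trans le_sup_left
  have h0 : row₀ p ≤ ((torus p ⊔ row₂ p) ⊔ row₁ p) ⊔ row₀ p := le_sup_right
  have hc {c : Fin 5} (hc : 2 < c) : e p 3 0 c ∈ row₀ p := by
    refine centralRoot_le_row₀ hc ?_
    rw [← e_mul 0 1 c (by decide) (by omega) (by decide)]
    exact commutator_mem_commutator self_mem_conjClosure self_mem_conjClosure
  refine closure_generators (hD d₂_mem_torus) (hD d₃_mem_torus) ?_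
  intro i j hij
  obtain ⟨rfl, rfl⟩ | ⟨rfl, rfl⟩ | ⟨rfl, hj⟩ | ⟨rfl, rfl⟩ | ⟨rfl, hj⟩ | ⟨rfl, rfl⟩ | ⟨rfl, rfl⟩ :
      (i = 0 ∧ j = 1) ∨ (i = 0 ∧ j = 2) ∨ (i = 0 ∧ 2 < j) ∨ (i = 1 ∧ j = 2) ∨ (i = 1 ∧ 2 < j) ∨
      (i = 2 ∧ j = 3) ∨ (i = 2 ∧ j = 4) := by omega
  · exact h0 (root_01_le_row₀ self_mem_conjClosure)
  · exact h0 (root_02_le_row₀ self_mem_conjClosure)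
  · exact h0 (hc hj)
  · exact h1 (le_sup_left (a := root p 1 2) self_mem_conjClosure)
  · exact h1 (root_1_le_row₁ hj self_mem_conjClosure)
  · exact h2 (le_sup_left (a := root p 2 3) self_mem_conjClosure)
  · exact h2 (le_sup_right (a := root p 2 3) self_mem_conjClosure)

theorem exists_rows (h : AbelsPresented p 3) :
    ∃ d ∈ torus p, ∃ r₂ ∈ row₂ p, ∃ r₁ ∈ row₁ p, ∃ r₀ ∈ row₀ p, h = d * r₂ * r₁ * r₀ := by
  have hh : h ∈ ((torus p ⊔ row₂ p) ⊔ row₁ p) ⊔ row₀ p := by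
    rw [sup_rows_eq_top]
    exact mem_top h
  have h1 : torus p ⊔ row₂ p ≤ normalizer (row₁ p : Set (AbelsPresented p 3)) :=
    sup_le torus_le_normalizer_row₁ row₂_le_normalizer_row₁
  have h0 : torus p ⊔ row₂ p ⊔ row₁ p ≤ normalizer (row₀ p : Set (AbelsPresented p 3)) :=
    sup_le (sup_le torus_le_normalizer_row₀ row₂_le_normalizer_row₀) row₁_le_normalizer_row₀
  obtain ⟨x, hx, r₀, hr₀, hh⟩ := exists_mul_of_mem_sup h0 hh
  obtain ⟨y, hy, r₁, hr₁, hx⟩ := exists_mul_of_mem_sup h1 hx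
  obtain ⟨d, hd, r₂, hr₂, hy⟩ := exists_mul_of_mem_sup torus_le_normalizer_row₂ hy
  exact ⟨d, hd, r₂, hr₂, r₁, hr₁, r₀, hr₀, by rw [hh, hx, hy]⟩

theorem exists_of_mem_row₂ {x : AbelsPresented p 3} (hx : x ∈ row₂ p) :
    ∃ a ∈ root p 2 3, ∃ b ∈ root p 2 4, x = a * b :=
  exists_mul_of_mem_sup
    (le_normalizer_of_commutator_eq_bot (commutator_root_2_2 two_lt_three two_lt_four)) hx

theorem exists_of_mem_row₁ {x : AbelsPresented p 3} (hx : x ∈ row₁ p) :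
    ∃ a ∈ root p 1 2, ∃ b ∈ root p 1 3, ∃ c ∈ root p 1 4, x = a * b * c := by
  have h {c : Fin 5} (hc : 2 < c) : root p 1 2 ≤ normalizer (root p 1 c : Set _) :=
    le_normalizer_of_commutator_eq_bot ((commutator_comm _ _).trans (commutator_root_1_12 hc))
  obtain ⟨a, ha, y, hy, rfl⟩ := exists_mul_of_mem_sup
    (le_normalizer_sup (h two_lt_three) (h two_lt_four)) hx
  obtain ⟨b, hb, c, hc, rfl⟩ := exists_mul_of_mem_sup
    (le_normalizer_of_commutator_eq_bot (commutator_root_1_1 two_lt_three two_lt_four)) hy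
  exact ⟨a, ha, b, hb, c, hc, (mul_assoc _ _ _).symm⟩

theorem root_0_le_normalizer_centralRoots {H : Subgroup (AbelsPresented p 3)}
    (h : ∀ c, 2 < c → ⁅H, centralRoot p c⁆ = ⊥) :
    H ≤ normalizer ((centralRoot p 3 ⊔ centralRoot p 4 : Subgroup _) : Set _) :=
  le_normalizer_sup (le_normalizer_of_commutator_eq_bot (h 3 two_lt_three))
    (le_normalizer_of_commutator_eq_bot (h 4 two_lt_four))

theorem exists_of_mem_row₀ {x : AbelsPresented p 3} (hx : x ∈ row₀ p) :
    ∃ a ∈ root p 0 1, ∃ b ∈ root p 0 2, ∃ c ∈ centralRoot p 3, ∃ d ∈ centralRoot p 4,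
      x = a * b * (c * d) := by
  have h1 := root_0_le_normalizer_centralRoots (p := p) fun _ ↦ commutator_root_01_centralRoot
  have h2 := root_0_le_normalizer_centralRoots (p := p) fun _ ↦ commutator_root_02_centralRoot
  have h3 : root p 0 1 ≤ normalizer (root p 0 2 : Set (AbelsPresented p 3)) :=
    le_normalizer_of_commutator_eq_bot commutator_root_01_02
  have h4 : centralRoot p 3 ≤ normalizer (centralRoot p 4 : Set (AbelsPresented p 3)) :=
    le_normalizer_of_commutator_eq_bot
      (commutator_centralRoot_centralRoot two_lt_three two_lt_four)
  obtain ⟨a, ha, y, hy, rfl⟩ := exists_mul_of_mem_sup (le_normalizer_sup h3 h1) hx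
  obtain ⟨b, hb, z, hz, rfl⟩ := exists_mul_of_mem_sup h2 hy
  obtain ⟨c, hc, d, hd, rfl⟩ := exists_mul_of_mem_sup h4 hz
  exact ⟨a, ha, b, hb, c, hc, d, hd, (mul_assoc a b (c * d)).symm⟩

/-! ### Passage from three rows to four -/

/-- The homomorphism between the presented groups that fixes the generators. -/
def inclusion (p : ℕ) : AbelsPresented p 3 →* AbelsPresented p 4 :=
  PresentedGroup.toGroup (f := fun
    | .d₂ => d₂ p 4
    | .d₃ => d₃ p 4
    | .e i j _ => e p 4 i j) <| by
  have lift_D₂ : ∀ f : AbelsGen 3 → AbelsPresented p 4, FreeGroup.lift f (D₂ 3) = f .d₂ :=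
    fun _ ↦ FreeGroup.lift_apply_of
  have lift_D₃ : ∀ f : AbelsGen 3 → AbelsPresented p 4, FreeGroup.lift f (D₃ 3) = f .d₃ :=
    fun _ ↦ FreeGroup.lift_apply_of
  have lift_E : ∀ (f : AbelsGen 3 → AbelsPresented p 4) (i j : Fin 5) (h : i < j ∧ i.val < 3),
    FreeGroup.lift f (E i j h) = f (.e i j h) := fun _ _ _ _ ↦ FreeGroup.lift_apply_of
  intro r hr
  cases hr with
  | d₂_d₃ =>
    rw [map_commutatorElement, commutatorElement_eq_one_iff_commute, lift_D₂, lift_D₃]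
    exact commute_d₂_d₃
  | d₂_row j h =>
    simp only [map_mul, map_inv, map_pow, mul_inv_eq_one, lift_D₂, lift_E]
    exact d₂_row j h.1 (by decide)
  | d₂_col i h =>
    obtain rfl : i = 0 := by omega
    simp only [map_mul, map_inv, map_pow, mul_inv_eq_one, lift_D₂, lift_E]
    exact d₂_col (by decide)
  | d₂_comm i j h hi hj =>
    rw [map_commutatorElement, commutatorElement_eq_one_iff_commute, lift_D₂, lift_E]
    exact d₂_comm i j hi hj
  | d₃_row j h =>
    simp only [map_mul, map_inv, map_pow, mul_inv_eq_one, lift_D₃, lift_E]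
    exact d₃_row j h.1 (by decide)
  | d₃_col i h =>
    simp only [map_mul, map_inv, map_pow, mul_inv_eq_one, lift_D₃, lift_E]
    exact d₃_col i h.1 (by omega)
  | d₃_comm i j h hi hj =>
    rw [map_commutatorElement, commutatorElement_eq_one_iff_commute, lift_D₃, lift_E]
    exact d₃_comm i j hi hj
  | e_comm i j k l h h' hik hjk =>
    rw [map_commutatorElement, commutatorElement_eq_one_iff_commute, lift_E, lift_E]
    exact e_comm i j k l hik hjk
  | e_mul i j l h h' h'' =>
    simp only [map_mul, map_inv, map_commutatorElement, mul_inv_eq_one, lift_E]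
    exact e_mul i j l h.1 h'.1 (by omega)

theorem inclusion_d₂ : inclusion p (d₂ p 3) = d₂ p 4 := PresentedGroup.toGroup.of _

theorem inclusion_d₃ : inclusion p (d₃ p 3) = d₃ p 4 := PresentedGroup.toGroup.of _

theorem inclusion_e {i j : Fin 5} (h : i < j ∧ i.val < 3) :
    inclusion p (e p 3 i j) = e p 4 i j := by
  rw [e_of h]
  exact PresentedGroup.toGroup.of _

theorem conj_zpow_mem_range (x : AbelsPresented p 3) (k : ℤ) :
    e p 4 3 4 ^ k * inclusion p x * (e p 4 3 4 ^ k)⁻¹ ∈ (inclusion p).range := by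
  have fixed {x : AbelsPresented p 3} (h : Commute (e p 4 3 4) (inclusion p x)) :
      x ∈ (inclusion p).range.comap ((MulAut.conj (e p 4 3 4 ^ k)).toMonoidHom.comp
        (inclusion p)) := by
    refine ⟨x, ?_⟩
    rw [MonoidHom.comp_apply, MulEquiv.coe_toMonoidHom, MulAut.conj_apply, (h.zpow_left k).eq,
      mul_inv_cancel_right]
  have : (inclusion p).range.comap ((MulAut.conj (e p 4 3 4 ^ k)).toMonoidHom.comp
      (inclusion p)) = ⊤ := by
    refine closure_generators (fixed ?_) (fixed ?_) fun i j h ↦ ?_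
    · rw [inclusion_d₂]
      exact (d₂_comm _ _ (by decide) (by decide)).symm
    · rw [inclusion_d₃]
      exact (d₃_comm _ _ (by decide) (by decide)).symm
    · by_cases hj : j = 3
      · subst hj
        have hi4 : i < 4 := by omega
        have h1 : ⁅e p 4 i 3, e p 4 3 4⁆ = e p 4 i 4 := e_mul _ _ _ h.1 (by decide) (by decide)
        have h2 : Commute (e p 4 i 4) (e p 4 3 4) := e_comm _ _ _ _ (by omega) (by decide)
        have h3 : e p 4 i 3 * e p 4 3 4 ^ k * (e p 4 i 3)⁻¹ = e p 4 i 4 ^ k * e p 4 3 4 ^ k := by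
          rw [← conj_zpow, ← h2.mul_zpow, ← h1]
          simp [commutatorElement_def]
        have h4 : e p 4 3 4 ^ k * e p 4 i 3 * (e p 4 3 4 ^ k)⁻¹ =
            (e p 4 i 4 ^ k)⁻¹ * e p 4 i 3 := by
          rw [mul_inv_eq_iff_eq_mul, mul_assoc, eq_inv_mul_iff_mul_eq, ← mul_assoc, ← h3]
          group
        refine ⟨(e p 3 i 4 ^ k)⁻¹ * e p 3 i 3, ?_⟩
        simp only [MonoidHom.comp_apply, MulEquiv.coe_toMonoidHom, MulAut.conj_apply]
        rw [map_mul, map_inv, map_zpow, inclusion_e h, inclusion_e ⟨hi4, h.2⟩, h4]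
      · refine fixed ?_
        rw [inclusion_e h]
        exact (e_comm _ _ _ _ (by omega) hj).symm
  exact (this ▸ mem_top x : x ∈ (inclusion p).range.comap _)

theorem exists_zpow_mul_inclusion (x : AbelsPresented p 4) :
    ∃ (k : ℤ) (y : AbelsPresented p 3), x = e p 4 3 4 ^ k * inclusion p y := by
  have hN : zpowers (e p 4 3 4) ≤ normalizer ((inclusion p).range : Set (AbelsPresented p 4)) := by
    rw [le_normalizer_iff]
    rintro _ ⟨k, rfl⟩ _ ⟨y, rfl⟩
    exact conj_zpow_mem_range y k
  have htop : zpowers (e p 4 3 4) ⊔ (inclusion p).range = ⊤ := by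
    refine closure_generators ?_ ?_ fun i j h ↦ ?_
    · exact le_sup_right (a := zpowers (e p 4 3 4)) ⟨_, inclusion_d₂⟩
    · exact le_sup_right (a := zpowers (e p 4 3 4)) ⟨_, inclusion_d₃⟩
    · by_cases hi : i.val < 3
      · exact le_sup_right (a := zpowers (e p 4 3 4)) ⟨_, inclusion_e ⟨h.1, hi⟩⟩
      · obtain ⟨rfl, rfl⟩ : i = 3 ∧ j = 4 := by omega
        exact le_sup_left (a := zpowers (e p 4 3 4)) (mem_zpowers _)
  obtain ⟨_, ⟨k, rfl⟩, _, ⟨y, rfl⟩, h⟩ := exists_mul_of_mem_sup hN (htop ▸ mem_top x)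
  exact ⟨k, y, h⟩

end AbelsPresented

/-! ### Transvections and diagonal matrices -/

namespace AbelsMatrix

/-- The elementary matrix `1 + r e_{ij}` as an invertible matrix. -/
def transvectionGL (i j : Fin 5) (h : i ≠ j) (r : ℚ) : GL (Fin 5) ℚ where
  val := Matrix.transvection i j r
  inv := Matrix.transvection i j (-r)
  val_inv := by simp [Matrix.transvection_mul_transvection_same, h]
  inv_val := by simp [Matrix.transvection_mul_transvection_same, h]

/-- The diagonal matrix with the given units on the diagonal. -/
def diagonalGL : (Fin 5 → ℚˣ) →* GL (Fin 5) ℚ :=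
  (Units.map (Matrix.diagonalRingHom (Fin 5) ℚ).toMonoidHom).comp
    (MulEquiv.piUnits (M := fun _ : Fin 5 ↦ ℚ)).symm.toMonoidHom

theorem diagonalGL_val (v : Fin 5 → ℚˣ) :
    (diagonalGL v).val = Matrix.diagonal fun i ↦ (v i : ℚ) := rfl

variable {i j k l : Fin 5}

theorem transvectionGL_val (h : i ≠ j) (r : ℚ) :
    (transvectionGL i j h r).val = 1 + Matrix.single i j r := rfl

theorem transvectionGL_zero (h : i ≠ j) : transvectionGL i j h 0 = 1 :=
  Units.ext (by simp [transvectionGL_val])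

theorem transvectionGL_mul (h : i ≠ j) (r s : ℚ) :
    transvectionGL i j h r * transvectionGL i j h s = transvectionGL i j h (r + s) :=
  Units.ext (Matrix.transvection_mul_transvection_same i j h r s)

theorem transvectionGL_inv (h : i ≠ j) (r : ℚ) :
    (transvectionGL i j h r)⁻¹ = transvectionGL i j h (-r) := by
  rw [inv_eq_iff_mul_eq_one, transvectionGL_mul, add_neg_cancel, transvectionGL_zero]

theorem transvectionGL_pow (h : i ≠ j) (r : ℚ) (n : ℕ) :
    transvectionGL i j h r ^ n = transvectionGL i j h (n * r) := by
  induction n with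
  | zero => simp [transvectionGL_zero]
  | succ n ih => rw [pow_succ, ih, transvectionGL_mul]; congr 1; push_cast; ring

theorem transvectionGL_zpow (h : i ≠ j) (r : ℚ) (n : ℤ) :
    transvectionGL i j h r ^ n = transvectionGL i j h (n * r) := by
  obtain ⟨n, rfl | rfl⟩ := n.eq_nat_or_neg
  · simp [transvectionGL_pow]
  · simp [transvectionGL_pow, transvectionGL_inv]

theorem transvectionGL_eq_one (h : i ≠ j) {r : ℚ} (hr : transvectionGL i j h r = 1) : r = 0 := by
  have : (transvectionGL i j h r).val i j = (1 : Matrix (Fin 5) (Fin 5) ℚ) i j := by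
    rw [hr, Units.val_one]
  simpa [transvectionGL_val, h] using this

theorem transvectionGL_commute (h : i ≠ j) (h' : k ≠ l) (hjk : j ≠ k) (hil : i ≠ l) (r s : ℚ) :
    Commute (transvectionGL i j h r) (transvectionGL k l h' s) := by
  refine Units.ext ?_
  simp only [Units.val_mul, transvectionGL_val, mul_add, add_mul, mul_one, one_mul,
    Matrix.single_mul_single_of_ne _ _ _ _ hjk, Matrix.single_mul_single_of_ne _ _ _ _ hil.symm]
  abel

theorem transvectionGL_commutator (hij : i ≠ j) (hjl : j ≠ l) (hil : i ≠ l) (r s : ℚ) :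
    ⁅transvectionGL i j hij r, transvectionGL j l hjl s⁆ = transvectionGL i l hil (r * s) := by
  rw [commutatorElement_def, mul_inv_eq_iff_eq_mul, mul_inv_eq_iff_eq_mul]
  refine Units.ext ?_
  simp only [Units.val_mul, transvectionGL_val, mul_add, add_mul, mul_one, one_mul,
    Matrix.single_mul_single_same, Matrix.single_mul_single_of_ne _ _ _ _ hil.symm,
    Matrix.single_mul_single_of_ne _ _ _ _ hjl.symm]
  simp
  abel

theorem diagonalGL_conj (v : Fin 5 → ℚˣ) (h : i ≠ j) (r : ℚ) :
    diagonalGL v * transvectionGL i j h r * (diagonalGL v)⁻¹ =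
      transvectionGL i j h (v i * r * (v j)⁻¹) := by
  rw [mul_inv_eq_iff_eq_mul]
  refine Units.ext ?_
  ext a b
  simp only [Units.val_mul, diagonalGL_val, transvectionGL_val, Matrix.diagonal_mul,
    Matrix.mul_diagonal, Matrix.add_apply, Matrix.one_apply, Matrix.single_apply]
  by_cases hab : a = b
  · subst hab
    have : ¬(i = a ∧ j = a) := fun h' ↦ h (h'.1.trans h'.2.symm)
    simp [this]
  · by_cases h' : i = a ∧ j = b
    · obtain ⟨rfl, rfl⟩ := h'
      simp [hab]
    · simp [hab, h']

theorem diagonalGL_commute {v : Fin 5 → ℚˣ} (h : i ≠ j) (hv : v i = v j) (r : ℚ) :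
    Commute (diagonalGL v) (transvectionGL i j h r) := by
  rw [Commute, SemiconjBy, ← mul_inv_eq_iff_eq_mul, diagonalGL_conj, hv, mul_comm,
    ← mul_assoc]
  simp

/-- The normal form of an element of the group with three rows, as a matrix. -/
theorem normalForm_val (v : Fin 5 → ℚˣ) (a b c d e f g h k : ℚ) :
    (diagonalGL v * (transvectionGL 2 3 (by decide) a * transvectionGL 2 4 (by decide) b) *
      (transvectionGL 1 2 (by decide) c * transvectionGL 1 3 (by decide) d *
        transvectionGL 1 4 (by decide) e) *
      (transvectionGL 0 1 (by decide) f * transvectionGL 0 2 (by decide) g *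
        (transvectionGL 0 3 (by decide) h * transvectionGL 0 4 (by decide) k))).val =
    Matrix.diagonal (fun i ↦ (v i : ℚ)) *
      !![1, f, g, h, k; 0, 1, c, d, e; 0, 0, 1, a, b; 0, 0, 0, 1, 0; 0, 0, 0, 0, 1] := by
  have h2 : (transvectionGL 2 3 (by decide) a * transvectionGL 2 4 (by decide) b).val =
      !![1, 0, 0, 0, 0; 0, 1, 0, 0, 0; 0, 0, 1, a, b; 0, 0, 0, 1, 0; 0, 0, 0, 0, 1] := by
    ext i j
    fin_cases i <;> fin_cases j <;>
      simp [transvectionGL_val, Matrix.mul_apply, Fin.sum_univ_five, Matrix.single_apply,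
        Matrix.one_apply]
  have h1 : (transvectionGL 1 2 (by decide) c * transvectionGL 1 3 (by decide) d *
        transvectionGL 1 4 (by decide) e).val =
      !![1, 0, 0, 0, 0; 0, 1, c, d, e; 0, 0, 1, 0, 0; 0, 0, 0, 1, 0; 0, 0, 0, 0, 1] := by
    ext i j
    fin_cases i <;> fin_cases j <;>
      simp [transvectionGL_val, Matrix.mul_apply, Fin.sum_univ_five, Matrix.single_apply,
        Matrix.one_apply]
  have h0 : (transvectionGL 0 1 (by decide) f * transvectionGL 0 2 (by decide) g *
        (transvectionGL 0 3 (by decide) h * transvectionGL 0 4 (by decide) k)).val =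
      !![1, f, g, h, k; 0, 1, 0, 0, 0; 0, 0, 1, 0, 0; 0, 0, 0, 1, 0; 0, 0, 0, 0, 1] := by
    ext i j
    fin_cases i <;> fin_cases j <;>
      simp [transvectionGL_val, Matrix.mul_apply, Fin.sum_univ_five, Matrix.single_apply,
        Matrix.one_apply]
  rw [Units.val_mul, Units.val_mul, Units.val_mul (diagonalGL v), diagonalGL_val, h2, h1, h0,
    mul_assoc, mul_assoc]
  congr 1
  ext i j
  fin_cases i <;> fin_cases j <;> simp [Matrix.mul_apply, Fin.sum_univ_five]

theorem isGTildeMatrix_diagonal {p : ℕ} (m n : ℤ) :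
    IsGTildeMatrix p (Matrix.diagonal ![1, (p : ℚ) ^ m, (p : ℚ) ^ n, 1, 1]) := by
  refine ⟨0, zero_mem _, 0, zero_mem _, 0, zero_mem _, 0, zero_mem _, 0, zero_mem _,
    0, zero_mem _, 0, zero_mem _, 0, zero_mem _, 0, zero_mem _, m, n, 0, ?_⟩
  ext i j
  fin_cases i <;> fin_cases j <;> simp

/-! ### The representation of the presented group -/

open AbelsGen AbelsPresented

variable (p : ℕ) [Fact p.Prime]

/-- The prime `p` as a unit of `ℚ`. -/
def primeUnit : ℚˣ := Units.mk0 (p : ℚ) (Nat.cast_ne_zero.2 (Fact.out : p.Prime).ne_zero)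

theorem primeUnit_val : (primeUnit p : ℚ) = p := rfl

/-- The matrices to which the generators are sent. -/
def genGL (s : ℕ) : AbelsGen s → GL (Fin 5) ℚ
  | .d₂ => diagonalGL (Pi.mulSingle 1 (primeUnit p))
  | .d₃ => diagonalGL (Pi.mulSingle 2 (primeUnit p))
  | .e i j h => transvectionGL i j h.1.ne 1

variable {p} in
theorem lift_genGL_eq_one {s : ℕ} {r : FreeGroup (AbelsGen s)} (hr : AbelsRelator p s r) :
    FreeGroup.lift (genGL p s) r = 1 := by
  have hE {i j : Fin 5} (h : i < j ∧ i.val < s) :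
      FreeGroup.lift (genGL p s) (E i j h) = transvectionGL i j h.1.ne 1 := FreeGroup.lift_apply_of
  have h₂ : FreeGroup.lift (genGL p s) (D₂ s) = diagonalGL (Pi.mulSingle 1 (primeUnit p)) :=
    FreeGroup.lift_apply_of
  have h₃ : FreeGroup.lift (genGL p s) (D₃ s) = diagonalGL (Pi.mulSingle 2 (primeUnit p)) :=
    FreeGroup.lift_apply_of
  cases hr with
  | d₂_d₃ =>
    rw [map_commutatorElement, h₂, h₃, commutatorElement_eq_one_iff_commute]
    exact (Commute.all _ _).map diagonalGL
  | d₂_row j h =>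
    have hj : j ≠ 1 := h.1.ne'
    simp only [map_mul, map_inv, map_pow, h₂, hE, mul_inv_eq_one, diagonalGL_conj,
      transvectionGL_pow]
    simp [hj, primeUnit_val]
  | d₂_col i h =>
    have hi : i ≠ 1 := h.1.ne
    simp only [map_mul, map_inv, map_pow, h₂, hE, mul_inv_eq_one, transvectionGL_pow]
    -- the relation is one about conjugation by the inverse diagonal matrix
    rw [← map_inv, ← inv_inv (diagonalGL (Pi.mulSingle 1 (primeUnit p))), ← map_inv,
      diagonalGL_conj]
    simp [hi, primeUnit_val]
  | d₂_comm i j h hi hj =>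
    rw [map_commutatorElement, h₂, hE, commutatorElement_eq_one_iff_commute]
    exact diagonalGL_commute _ (by simp [hi, hj]) _
  | d₃_row j h =>
    have hj : j ≠ 2 := h.1.ne'
    simp only [map_mul, map_inv, map_pow, h₃, hE, mul_inv_eq_one, diagonalGL_conj,
      transvectionGL_pow]
    simp [hj, primeUnit_val]
  | d₃_col i h =>
    have hi : i ≠ 2 := h.1.ne
    simp only [map_mul, map_inv, map_pow, h₃, hE, mul_inv_eq_one, transvectionGL_pow]
    -- the relation is one about conjugation by the inverse diagonal matrix
    rw [← map_inv, ← inv_inv (diagonalGL (Pi.mulSingle 2 (primeUnit p))), ← map_inv,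
      diagonalGL_conj]
    simp [hi, primeUnit_val]
  | d₃_comm i j h hi hj =>
    rw [map_commutatorElement, h₃, hE, commutatorElement_eq_one_iff_commute]
    exact diagonalGL_commute _ (by simp [hi, hj]) _
  | e_comm i j k l h h' hik hjk =>
    rw [map_commutatorElement, hE, hE, commutatorElement_eq_one_iff_commute]
    exact transvectionGL_commute _ _ hjk (hik.trans_lt h'.1).ne _ _
  | e_mul i j l h h' h'' =>
    rw [map_mul, map_inv, map_commutatorElement, hE, hE, hE, mul_inv_eq_one,
      transvectionGL_commutator _ _ h''.1.ne, one_mul]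

/-- The homomorphism to the invertible matrices that is prescribed on the generators. -/
def toGL (s : ℕ) : AbelsPresented p s →* GL (Fin 5) ℚ :=
  PresentedGroup.toGroup (f := genGL p s) fun _ ↦ lift_genGL_eq_one

theorem toGL_d₂ (s : ℕ) : toGL p s (d₂ p s) = diagonalGL (Pi.mulSingle 1 (primeUnit p)) :=
  PresentedGroup.toGroup.of _

theorem toGL_d₃ (s : ℕ) : toGL p s (d₃ p s) = diagonalGL (Pi.mulSingle 2 (primeUnit p)) :=
  PresentedGroup.toGroup.of _

theorem toGL_e {s : ℕ} {i j : Fin 5} (h : i < j ∧ i.val < s) :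
    toGL p s (e p s i j) = transvectionGL i j h.1.ne 1 := by
  rw [e_of h]
  exact PresentedGroup.toGroup.of _

/-! ### Injectivity for three rows -/

open Subgroup

/-- The elementary matrices at a given position. -/
def transvectionSubgroup (i j : Fin 5) (h : i ≠ j) : Subgroup (GL (Fin 5) ℚ) where
  carrier := Set.range (transvectionGL i j h)
  one_mem' := ⟨0, transvectionGL_zero h⟩
  mul_mem' := by
    rintro _ _ ⟨r, rfl⟩ ⟨s, rfl⟩
    exact ⟨r + s, (transvectionGL_mul h r s).symm⟩
  inv_mem' := by
    rintro _ ⟨r, rfl⟩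
    exact ⟨-r, (transvectionGL_inv h r).symm⟩

variable {p}

theorem exists_diagonal_of_mem_torus {d : AbelsPresented p 3} (hd : d ∈ torus p) :
    ∃ m n : ℤ, d = d₂ p 3 ^ m * d₃ p 3 ^ n ∧
      toGL p 3 d =
        diagonalGL (Pi.mulSingle 1 (primeUnit p ^ m) * Pi.mulSingle 2 (primeUnit p ^ n)) := by
  obtain ⟨m, n, rfl⟩ := torus_d₂_d₃ d hd
  refine ⟨m, n, rfl, ?_⟩
  rw [map_mul, map_zpow, map_zpow, toGL_d₂, toGL_d₃, ← map_zpow, ← map_zpow, ← map_mul,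
    Pi.mulSingle_zpow, Pi.mulSingle_zpow]

theorem exists_of_mem_root {i j : Fin 5} (h : i < j ∧ i.val < 3) {x : AbelsPresented p 3}
    (hx : x ∈ root p i j) : ∃ r, toGL p 3 x = transvectionGL i j h.1.ne r := by
  have hle : root p i j ≤ (transvectionSubgroup i j h.1.ne).comap (toGL p 3) := by
    refine (closure_le _).2 ?_
    rintro _ ⟨d, hd, rfl⟩
    obtain ⟨m, n, -, hd⟩ := exists_diagonal_of_mem_torus hd
    rw [SetLike.mem_coe, mem_comap, map_mul, map_mul, map_inv, hd, toGL_e p h, diagonalGL_conj]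
    exact ⟨_, rfl⟩
  obtain ⟨r, hr⟩ := hle hx
  exact ⟨r, hr.symm⟩

theorem eq_one_of_exists_of_mem_torus {i j : Fin 5} (h : i < j ∧ i.val < 3)
    {δ a : AbelsPresented p 3} (hδ : δ * e p 3 i j * δ⁻¹ = e p 3 i j ^ p)
    (hD : ∀ d ∈ torus p, ∃ m n : ℤ, d = δ ^ m * a ^ n) (ha : Commute a (e p 3 i j))
    {x : AbelsPresented p 3} (hx : x ∈ root p i j) (h1 : toGL p 3 x = 1) : x = 1 := by
  obtain ⟨n, hn⟩ := exists_of_mem_conjClosure hδ hD ha hx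
  obtain ⟨k, rfl⟩ := hn n le_rfl
  have hk : toGL p 3 (e p 3 i j ^ k) = 1 := by
    rw [map_mul, map_mul, map_inv] at h1
    rw [← conj_eq_one_iff (a := (toGL p 3 (δ ^ n))⁻¹), inv_inv, h1]
  rw [map_zpow, toGL_e p h, transvectionGL_zpow] at hk
  have hk0 : k = 0 := by simpa using transvectionGL_eq_one _ hk
  simp [hk0]

theorem eq_one_of_mem_root {i j : Fin 5} (h : i < j ∧ i.val < 3) (hij : i = 0 → j < 3)
    {x : AbelsPresented p 3} (hx : x ∈ root p i j) (h1 : toGL p 3 x = 1) : x = 1 := by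
  obtain ⟨rfl, rfl⟩ | ⟨rfl, rfl⟩ | ⟨rfl, rfl⟩ | ⟨rfl, hj⟩ | ⟨rfl, hj⟩ :
      (i = 0 ∧ j = 1) ∨ (i = 0 ∧ j = 2) ∨ (i = 1 ∧ j = 2) ∨ (i = 1 ∧ 2 < j) ∨
      (i = 2 ∧ 2 < j) := by omega
  · exact eq_one_of_exists_of_mem_torus h (δ := (d₂ p 3)⁻¹) (by simpa using d₂_col (by decide))
      (exists_zpow_inv_mul_zpow torus_d₂_d₃) (d₃_comm _ _ (by decide) (by decide)) hx h1
  · exact eq_one_of_exists_of_mem_torus h (δ := (d₃ p 3)⁻¹)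
      (by simpa using d₃_col 0 (by decide) (by decide))
      (exists_zpow_inv_mul_zpow torus_d₃_d₂) (d₂_comm _ _ (by decide) (by decide)) hx h1
  · exact eq_one_of_exists_of_mem_torus h (d₂_row 2 (by decide) (by decide)) torus_d₂_d₂d₃
      d₂d₃_comm hx h1
  · exact eq_one_of_exists_of_mem_torus h (d₂_row j (by omega) (by decide)) torus_d₂_d₃
      (d₃_comm_e₁ hj) hx h1
  · exact eq_one_of_exists_of_mem_torus h (d₃_row j hj (by decide)) torus_d₃_d₂
      (d₂_comm_e₂ hj) hx h1

/-- By `exists_of_mem_centralRoot` the elements of `centralRoot p c` are `⁅x, e_{1c}⁆`, whose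
matrix has the same entry as that of `x`, at another position. -/
theorem exists_transvection_of_mem_centralRoot {c : Fin 5} (hc : 2 < c) {v : AbelsPresented p 3}
    (hv : v ∈ centralRoot p c) :
    ∃ r, toGL p 3 v = transvectionGL 0 c (ne_of_two_lt hc).1.symm r ∧ (r = 0 → v = 1) := by
  obtain ⟨x, hx, rfl⟩ := exists_of_mem_centralRoot hc hv
  obtain ⟨r, hr⟩ := exists_of_mem_root (by decide) hx
  refine ⟨r, ?_, fun h0 ↦ ?_⟩
  · rw [map_commutatorElement, hr, toGL_e p (i := 1) (j := c) ⟨by omega, by decide⟩,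
      transvectionGL_commutator _ _ (ne_of_two_lt hc).1.symm, mul_one]
  · have := eq_one_of_mem_root (by decide) (by decide) hx
      (by rw [hr, h0, transvectionGL_zero])
    rw [this, commutatorElement_one_left]

theorem exists_transvection_of_mem_root {i j : Fin 5} (h : i < j ∧ i.val < 3)
    (hij : i = 0 → j < 3) {x : AbelsPresented p 3} (hx : x ∈ root p i j) :
    ∃ r, toGL p 3 x = transvectionGL i j h.1.ne r ∧ (r = 0 → x = 1) := by
  obtain ⟨r, hr⟩ := exists_of_mem_root h hx
  exact ⟨r, hr, fun h0 ↦ eq_one_of_mem_root h hij hx (by rw [hr, h0, transvectionGL_zero])⟩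

theorem primeUnit_zpow_eq_one {m : ℤ} (h : ((primeUnit p ^ m : ℚˣ) : ℚ) = 1) : m = 0 := by
  have hp : 1 < (p : ℚ) := by exact_mod_cast (Fact.out : p.Prime).one_lt
  rw [Units.val_zpow_eq_zpow_val, primeUnit_val] at h
  exact (zpow_eq_one_iff_right₀ (by positivity) hp.ne').1 h

/-- In a normal form for an element of the kernel, each factor is determined by one entry of the
identity matrix, so each factor is trivial. -/
theorem toGL_injective : Function.Injective (toGL p 3) := by
  refine (injective_iff_map_eq_one _).2 fun x hx ↦ ?_
  obtain ⟨d, hd, r₂, hr₂, r₁, hr₁, r₀, hr₀, hxeq⟩ := exists_rows x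
  obtain ⟨x₂₃, h₂₃, x₂₄, h₂₄, e₂⟩ := exists_of_mem_row₂ hr₂
  obtain ⟨x₁₂, h₁₂, x₁₃, h₁₃, x₁₄, h₁₄, e₁⟩ := exists_of_mem_row₁ hr₁
  obtain ⟨x₀₁, h₀₁, x₀₂, h₀₂, x₀₃, h₀₃, x₀₄, h₀₄, e₀⟩ := exists_of_mem_row₀ hr₀
  obtain ⟨m, n, ed, hd⟩ := exists_diagonal_of_mem_torus hd
  obtain ⟨a₂₃, m₂₃, z₂₃⟩ := exists_transvection_of_mem_root (by decide) (by decide) h₂₃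
  obtain ⟨a₂₄, m₂₄, z₂₄⟩ := exists_transvection_of_mem_root (by decide) (by decide) h₂₄
  obtain ⟨a₁₂, m₁₂, z₁₂⟩ := exists_transvection_of_mem_root (by decide) (by decide) h₁₂
  obtain ⟨a₁₃, m₁₃, z₁₃⟩ := exists_transvection_of_mem_root (by decide) (by decide) h₁₃
  obtain ⟨a₁₄, m₁₄, z₁₄⟩ := exists_transvection_of_mem_root (by decide) (by decide) h₁₄
  obtain ⟨a₀₁, m₀₁, z₀₁⟩ := exists_transvection_of_mem_root (by decide) (by decide) h₀₁
  obtain ⟨a₀₂, m₀₂, z₀₂⟩ := exists_transvection_of_mem_root (by decide) (by decide) h₀₂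
  obtain ⟨a₀₃, m₀₃, z₀₃⟩ := exists_transvection_of_mem_centralRoot two_lt_three h₀₃
  obtain ⟨a₀₄, m₀₄, z₀₄⟩ := exists_transvection_of_mem_centralRoot two_lt_four h₀₄
  -- the matrix of `x` in terms of the parameters of its factors; it is the identity matrix
  have key := normalForm_val (Pi.mulSingle 1 (primeUnit p ^ m) * Pi.mulSingle 2 (primeUnit p ^ n))
    a₂₃ a₂₄ a₁₂ a₁₃ a₁₄ a₀₁ a₀₂ a₀₃ a₀₄
  rw [← hd, ← m₂₃, ← m₂₄, ← m₁₂, ← m₁₃, ← m₁₄, ← m₀₁, ← m₀₂, ← m₀₃, ← m₀₄] at key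
  simp only [← map_mul] at key
  rw [← e₂, ← e₁, ← e₀, ← hxeq, hx, Units.val_one] at key
  have entry (i j : Fin 5) := congrFun (congrFun key i) j
  simp only [Matrix.diagonal_mul] at entry
  have hm : m = 0 := primeUnit_zpow_eq_one (by simpa using (entry 1 1).symm)
  have hn : n = 0 := primeUnit_zpow_eq_one (by simpa using (entry 2 2).symm)
  subst hm hn
  rw [hxeq, e₂, e₁, e₀, ed, z₂₃ (by simpa using (entry 2 3).symm),
    z₂₄ (by simpa using (entry 2 4).symm), z₁₂ (by simpa using (entry 1 2).symm),
    z₁₃ (by simpa using (entry 1 3).symm), z₁₄ (by simpa using (entry 1 4).symm),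
    z₀₁ (by simpa using (entry 0 1).symm), z₀₂ (by simpa using (entry 0 2).symm),
    z₀₃ (by simpa using (entry 0 3).symm), z₀₄ (by simpa using (entry 0 4).symm)]
  simp

/-! ### The image for three rows -/

theorem exists_mul_pow_of_mem_ZInv {r : ℚ} (hr : r ∈ ZInv p) :
    ∃ (n : ℕ) (k : ℤ), r * p ^ n = k := by
  have hp : (p : ℚ) ≠ 0 := Nat.cast_ne_zero.2 (Fact.out : p.Prime).ne_zero
  induction hr using Subring.closure_induction with
  | mem x hx =>
    rw [Set.mem_singleton_iff] at hx
    exact ⟨1, 1, by simp [hx, hp]⟩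
  | zero => exact ⟨0, 0, by simp⟩
  | one => exact ⟨0, 1, by simp⟩
  | add x y _ _ ihx ihy =>
    obtain ⟨n, k, hx⟩ := ihx
    obtain ⟨m, l, hy⟩ := ihy
    refine ⟨n + m, k * p ^ m + l * p ^ n, ?_⟩
    push_cast
    rw [← hx, ← hy]
    ring
  | neg x _ ih =>
    obtain ⟨n, k, hx⟩ := ih
    exact ⟨n, -k, by push_cast; rw [← hx]; ring⟩
  | mul x y _ _ ihx ihy =>
    obtain ⟨n, k, hx⟩ := ihx
    obtain ⟨m, l, hy⟩ := ihy
    refine ⟨n + m, k * l, ?_⟩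
    push_cast
    rw [← hx, ← hy]
    ring

theorem transvectionGL_mem_of_mem_ZInv {H : Subgroup (GL (Fin 5) ℚ)} {i j : Fin 5} (h : i ≠ j)
    {δ : GL (Fin 5) ℚ} (hδ : δ ∈ H) (h1 : transvectionGL i j h 1 ∈ H)
    (hconj : ∀ r, δ * transvectionGL i j h r * δ⁻¹ = transvectionGL i j h (r * p))
    {r : ℚ} (hr : r ∈ ZInv p) : transvectionGL i j h r ∈ H := by
  obtain ⟨n, k, hk⟩ := exists_mul_pow_of_mem_ZInv hr
  clear hr
  induction n generalizing r with
  | zero =>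
    have := zpow_mem h1 k
    rwa [transvectionGL_zpow, ← hk, pow_zero, mul_one, mul_one] at this
  | succ n ih =>
    have := ih (r := r * p) (by rw [← hk]; ring)
    rw [← hconj] at this
    simpa [mul_assoc] using mul_mem (mul_mem (inv_mem hδ) this) hδ

theorem toGL_torus_mem (v₁ v₂ : ℤ) :
    diagonalGL (Pi.mulSingle 1 (primeUnit p ^ v₁) * Pi.mulSingle 2 (primeUnit p ^ v₂)) ∈
      (toGL p 3).range :=
  ⟨d₂ p 3 ^ v₁ * d₃ p 3 ^ v₂, by
    rw [map_mul, map_zpow, map_zpow, toGL_d₂, toGL_d₃, ← map_zpow, ← map_zpow, ← map_mul,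
      Pi.mulSingle_zpow, Pi.mulSingle_zpow]⟩

theorem transvectionGL_mem_range {i j : Fin 5} (h : i < j ∧ i.val < 3) {r : ℚ}
    (hr : r ∈ ZInv p) : transvectionGL i j h.1.ne r ∈ (toGL p 3).range := by
  have h1 {i j : Fin 5} (h : i < j ∧ i.val < 3) : transvectionGL i j h.1.ne 1 ∈ (toGL p 3).range :=
    ⟨_, toGL_e p h⟩
  have h01 {r : ℚ} (hr : r ∈ ZInv p) : transvectionGL 0 1 (by decide) r ∈ (toGL p 3).range := by
    refine transvectionGL_mem_of_mem_ZInv _ (toGL_torus_mem (-1) 0) (h1 (by decide)) ?_ hr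
    intro r
    rw [diagonalGL_conj]
    simp [primeUnit_val]
  obtain ⟨rfl, rfl⟩ | ⟨rfl, rfl⟩ | ⟨rfl, hj⟩ | ⟨rfl, hj⟩ | ⟨rfl, hj⟩ :
      (i = 0 ∧ j = 1) ∨ (i = 0 ∧ j = 2) ∨ (i = 0 ∧ 2 < j) ∨ (i = 1 ∧ 1 < j) ∨
      (i = 2 ∧ 2 < j) := by omega
  · exact h01 hr
  · refine transvectionGL_mem_of_mem_ZInv _ (toGL_torus_mem 0 (-1)) (h1 (by decide)) ?_ hr
    intro r
    rw [diagonalGL_conj]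
    simp [primeUnit_val]
  -- the torus centralises `e_{0j}`, so this position is reached through a commutator
  · rw [← mul_one r, ← transvectionGL_commutator (j := 1) (by decide) (by omega),
      commutatorElement_def]
    have h1j := h1 (i := 1) (j := j) ⟨by omega, by decide⟩
    exact mul_mem (mul_mem (mul_mem (h01 hr) h1j) (inv_mem (h01 hr))) (inv_mem h1j)
  · refine transvectionGL_mem_of_mem_ZInv _ (toGL_torus_mem 1 0) (h1 h) ?_ hr
    intro r
    rw [diagonalGL_conj]
    simp [primeUnit_val, hj.ne', mul_comm]
  · refine transvectionGL_mem_of_mem_ZInv _ (toGL_torus_mem 0 1) (h1 h) ?_ hr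
    intro r
    rw [diagonalGL_conj]
    simp [primeUnit_val, hj.ne', mul_comm]

theorem GZero_le_range : GZero p ≤ (toGL p 3).range := by
  rintro g ⟨⟨x₀₁, h₀₁, x₀₂, h₀₂, x₀₃, h₀₃, x₀₄, h₀₄, x₁₂, h₁₂, x₁₃, h₁₃, x₁₄, h₁₄,
    x₂₃, h₂₃, x₂₄, h₂₄, m, n, k, hg⟩, hk⟩
  have hp : (p : ℚ) ≠ 0 := Nat.cast_ne_zero.2 (Fact.out : p.Prime).ne_zero
  have hk0 : (k : ℚ) = 0 := by simpa [hg] using hk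
  -- row `i` of the unipotent factor is row `i` of `g` divided by the diagonal entry
  have hinv {x : ℚ} (hx : x ∈ ZInv p) (m : ℤ) : p ^ (-m) * x ∈ ZInv p :=
    mul_mem (ZInv.zpow_mem p _) hx
  have key : g = _ := Units.ext <| Eq.trans ?_ (normalForm_val
    (Pi.mulSingle 1 (primeUnit p ^ m) * Pi.mulSingle 2 (primeUnit p ^ n))
    (p ^ (-n) * x₂₃) (p ^ (-n) * x₂₄) (p ^ (-m) * x₁₂) (p ^ (-m) * x₁₃) (p ^ (-m) * x₁₄)
    x₀₁ x₀₂ x₀₃ x₀₄).symm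
  · rw [key]
    exact mul_mem (mul_mem (mul_mem (toGL_torus_mem m n)
      (mul_mem (transvectionGL_mem_range (by decide) (hinv h₂₃ n))
        (transvectionGL_mem_range (by decide) (hinv h₂₄ n))))
      (mul_mem (mul_mem (transvectionGL_mem_range (by decide) (hinv h₁₂ m))
        (transvectionGL_mem_range (by decide) (hinv h₁₃ m)))
        (transvectionGL_mem_range (by decide) (hinv h₁₄ m))))
      (mul_mem (mul_mem (transvectionGL_mem_range (by decide) h₀₁)
        (transvectionGL_mem_range (by decide) h₀₂))
        (mul_mem (transvectionGL_mem_range (by decide) h₀₃)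
        (transvectionGL_mem_range (by decide) h₀₄)))
  · have hz (m : ℤ) : (p : ℚ) ^ m ≠ 0 := zpow_ne_zero m hp
    rw [hg, hk0]
    ext i j
    rw [Matrix.diagonal_mul]
    fin_cases i <;> fin_cases j <;> simp [primeUnit_val, hz]

theorem diagonalGL_mulSingle_one_val :
    (diagonalGL (Pi.mulSingle 1 (primeUnit p))).val = Matrix.diagonal ![1, (p : ℚ), 1, 1, 1] := by
  rw [diagonalGL_val]
  congr 1
  ext i
  fin_cases i <;> simp [primeUnit_val]

theorem diagonalGL_mulSingle_two_val :
    (diagonalGL (Pi.mulSingle 2 (primeUnit p))).val = Matrix.diagonal ![1, 1, (p : ℚ), 1, 1] := by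
  rw [diagonalGL_val]
  congr 1
  ext i
  fin_cases i <;> simp [primeUnit_val]

theorem transvectionGL_mem_GTilde {i j : Fin 5} (h : i < j) :
    transvectionGL i j h.ne 1 ∈ GTilde p := by
  have hA (a b : Fin 5) : (if i = a ∧ j = b then 1 else 0) ∈ ZInv p := by
    split_ifs
    exacts [one_mem _, zero_mem _]
  refine ⟨_, hA 0 1, _, hA 0 2, _, hA 0 3, _, hA 0 4, _, hA 1 2, _, hA 1 3, _, hA 1 4, _, hA 2 3,
    _, hA 2 4, 0, 0, if i = 3 ∧ j = 4 then 1 else 0, ?_⟩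
  rw [transvectionGL_val]
  ext a b
  rw [Matrix.add_apply, Matrix.single_apply]
  fin_cases a <;> fin_cases b <;> simp <;> omega

theorem toGL_mem_GTilde (s : ℕ) (x : AbelsPresented p s) : toGL p s x ∈ GTilde p := by
  have : (GTilde p).comap (toGL p s) = ⊤ := by
    refine closure_generators ?_ ?_ fun i j h ↦ ?_
    · rw [mem_comap, toGL_d₂]
      change IsGTildeMatrix p _
      rw [diagonalGL_mulSingle_one_val]
      simpa using isGTildeMatrix_diagonal 1 0
    · rw [mem_comap, toGL_d₃]
      change IsGTildeMatrix p _
      rw [diagonalGL_mulSingle_two_val]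
      simpa using isGTildeMatrix_diagonal 0 1
    · rw [mem_comap, toGL_e p h]
      exact transvectionGL_mem_GTilde h.1
  exact (this ▸ mem_top x : x ∈ (GTilde p).comap (toGL p s))

theorem range_le_GZero : (toGL p 3).range ≤ GZero p := by
  have : (GZero p).comap (toGL p 3) = ⊤ := by
    refine closure_generators ?_ ?_ fun i j h ↦ ?_
    · refine ⟨toGL_mem_GTilde 3 _, ?_⟩
      rw [toGL_d₂, diagonalGL_mulSingle_one_val]
      exact Matrix.diagonal_apply_ne _ (by decide)
    · refine ⟨toGL_mem_GTilde 3 _, ?_⟩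
      rw [toGL_d₃, diagonalGL_mulSingle_two_val]
      exact Matrix.diagonal_apply_ne _ (by decide)
    · refine ⟨toGL_mem_GTilde 3 _, ?_⟩
      rw [toGL_e p h, transvectionGL_val, Matrix.add_apply, Matrix.single_apply,
        if_neg (by omega), add_zero]
      exact Matrix.one_apply_ne (by decide)
  rintro _ ⟨x, rfl⟩
  exact (this ▸ mem_top x : x ∈ (GZero p).comap (toGL p 3))

/-! ### Injectivity and image for four rows -/

theorem toGL_inclusion (x : AbelsPresented p 3) : toGL p 4 (inclusion p x) = toGL p 3 x := by
  have : (toGL p 4).comp (inclusion p) = toGL p 3 := by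
    refine PresentedGroup.ext ?_
    rintro (_ | _ | ⟨i, j, h⟩)
    · change toGL p 4 (inclusion p (d₂ p 3)) = toGL p 3 (d₂ p 3)
      rw [inclusion_d₂, toGL_d₂, toGL_d₂]
    · change toGL p 4 (inclusion p (d₃ p 3)) = toGL p 3 (d₃ p 3)
      rw [inclusion_d₃, toGL_d₃, toGL_d₃]
    · rw [← e_of h, MonoidHom.comp_apply, inclusion_e h, toGL_e p h,
        toGL_e p ⟨h.1, h.2.trans (by decide)⟩]
  exact DFunLike.congr_fun this x

theorem toGL_e34_zpow (k : ℤ) :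
    toGL p 4 (e p 4 3 4 ^ k) = transvectionGL 3 4 (by decide) k := by
  rw [map_zpow, toGL_e p (i := 3) (j := 4) (by decide), transvectionGL_zpow, mul_one]

theorem transvectionGL_34_mul_apply (r : ℚ) (g : GL (Fin 5) ℚ) :
    (transvectionGL 3 4 (by decide) r * g).val 3 4 = g.val 3 4 + r * g.val 4 4 :=
  Matrix.transvection_mul_apply_same _ _ _ _ _

theorem val_four_four {g : GL (Fin 5) ℚ} (hg : g ∈ GTilde p) : g.val 4 4 = 1 := by
  obtain ⟨_, _, _, _, _, _, _, _, _, _, _, _, _, _, _, _, _, _, _, _, _, h⟩ := hg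
  rw [h]
  rfl

theorem toGL_four_injective : Function.Injective (toGL p 4) := by
  refine (injective_iff_map_eq_one _).2 fun x hx ↦ ?_
  obtain ⟨k, y, hxy⟩ := exists_zpow_mul_inclusion x
  rw [hxy, map_mul, toGL_e34_zpow, toGL_inclusion] at hx
  have hy : toGL p 3 y ∈ GZero p := range_le_GZero ⟨y, rfl⟩
  have hk := transvectionGL_34_mul_apply k (toGL p 3 y)
  rw [hx, hy.2, val_four_four hy.1, Units.val_one, Matrix.one_apply_ne (by decide), zero_add,
    mul_one] at hk
  rw [← hk, transvectionGL_zero, one_mul] at hx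
  have hk0 : k = 0 := by exact_mod_cast hk.symm
  rw [hxy, hk0, toGL_injective (hx.trans (map_one _).symm)]
  simp

theorem GTilde_le_range : GTilde p ≤ (toGL p 4).range := by
  intro g hg
  obtain ⟨k, hk⟩ : ∃ k : ℤ, g.val 3 4 = k := by
    obtain ⟨_, _, _, _, _, _, _, _, _, _, _, _, _, _, _, _, _, _, _, _, k, h⟩ := hg
    exact ⟨k, by rw [h]; rfl⟩
  have ht := toGL_mem_GTilde 4 (e p 4 3 4 ^ (-k))
  obtain ⟨y, hy⟩ : toGL p 4 (e p 4 3 4 ^ (-k)) * g ∈ (toGL p 3).range := by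
    refine GZero_le_range ⟨mul_mem ht hg, ?_⟩
    rw [toGL_e34_zpow, transvectionGL_34_mul_apply, hk, val_four_four hg]
    push_cast
    ring
  refine ⟨e p 4 3 4 ^ k * inclusion p y, ?_⟩
  rw [map_mul, toGL_inclusion, hy, ← mul_assoc, ← map_mul, ← zpow_add]
  simp

/-! ### The isomorphisms and finite presentability -/

theorem isStandardOnGenerators {s : ℕ} {H : Subgroup (GL (Fin 5) ℚ)} (φ : AbelsPresented p s ≃* H)
    (h : ∀ x, (φ x : GL (Fin 5) ℚ) = toGL p s x) : IsStandardOnGenerators φ := by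
  refine ⟨?_, ?_, fun i j hij ↦ ?_⟩
  · rw [h]
    exact (congrArg Units.val (toGL_d₂ p s)).trans diagonalGL_mulSingle_one_val
  · rw [h]
    exact (congrArg Units.val (toGL_d₃ p s)).trans diagonalGL_mulSingle_two_val
  · rw [h, ← e_of hij, toGL_e p hij, transvectionGL_val]

theorem exists_isStandardOnGenerators {s : ℕ} {H : Subgroup (GL (Fin 5) ℚ)}
    (hinj : Function.Injective (toGL p s)) (hH : (toGL p s).range = H) :
    ∃ φ : AbelsPresented p s ≃* H, IsStandardOnGenerators φ :=
  ⟨(MonoidHom.ofInjective hinj).trans (MulEquiv.subgroupCongr hH),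
    isStandardOnGenerators _ fun _ ↦ rfl⟩

instance (s : ℕ) : Finite (AbelsGen s) := by
  refine Finite.of_surjective
    (fun x : Bool ⊕ {q : Fin 5 × Fin 5 // q.1 < q.2 ∧ q.1.val < s} ↦ match x with
      | .inl true => AbelsGen.d₂
      | .inl false => AbelsGen.d₃
      | .inr q => AbelsGen.e q.1.1 q.1.2 q.2) ?_
  rintro (_ | _ | ⟨i, j, h⟩)
  exacts [⟨.inl true, rfl⟩, ⟨.inl false, rfl⟩, ⟨.inr ⟨(i, j), h⟩, rfl⟩]

/-- Every relator is one of four words, evaluated at up to three generators. -/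
theorem finite_relators (p s : ℕ) : {r | AbelsRelator p s r}.Finite := by
  let F (x y z : FreeGroup (AbelsGen s)) : Set (FreeGroup (AbelsGen s)) :=
    {⁅x, y⁆, x * y * x⁻¹ * (y ^ p)⁻¹, x⁻¹ * y * x * (y ^ p)⁻¹, ⁅x, y⁆ * z⁻¹}
  have hF : (⋃ x : AbelsGen s, ⋃ y : AbelsGen s, ⋃ z : AbelsGen s,
      F (.of x) (.of y) (.of z)).Finite :=
    Set.finite_iUnion fun x ↦ Set.finite_iUnion fun y ↦ Set.finite_iUnion fun z ↦ by simp [F]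
  have mem {r : FreeGroup (AbelsGen s)} (x y z : AbelsGen s)
      (h : r ∈ F (.of x) (.of y) (.of z)) : r ∈ ⋃ x : AbelsGen s, ⋃ y : AbelsGen s,
        ⋃ z : AbelsGen s, F (.of x) (.of y) (.of z) :=
    Set.mem_iUnion.2 ⟨x, Set.mem_iUnion.2 ⟨y, Set.mem_iUnion.2 ⟨z, h⟩⟩⟩
  refine hF.subset ?_
  rintro r hr
  cases hr with
  | d₂_d₃ => exact mem .d₂ .d₃ .d₂ (.inl rfl)
  | d₂_row j h => exact mem .d₂ (.e 1 j h) .d₂ (.inr (.inl rfl))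
  | d₂_col i h => exact mem .d₂ (.e i 1 h) .d₂ (.inr (.inr (.inl rfl)))
  | d₂_comm i j h => exact mem .d₂ (.e i j h) .d₂ (.inl rfl)
  | d₃_row j h => exact mem .d₃ (.e 2 j h) .d₂ (.inr (.inl rfl))
  | d₃_col i h => exact mem .d₃ (.e i 2 h) .d₂ (.inr (.inr (.inl rfl)))
  | d₃_comm i j h => exact mem .d₃ (.e i j h) .d₂ (.inl rfl)
  | e_comm i j k l h h' => exact mem (.e i j h) (.e k l h') .d₂ (.inl rfl)
  | e_mul i j l h h' h'' => exact mem (.e i j h) (.e j l h') (.e i l h'') (.inr (.inr (.inr rfl)))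

end AbelsMatrix

open AbelsMatrix in
theorem mainTheorem8 (p : ℕ) [Fact p.Prime] :
    Group.IsFinitelyPresented (GTilde p) ∧
    (∃ φ : AbelsPresented p 3 ≃* GZero p, IsStandardOnGenerators φ) ∧
    (∃ φ : AbelsPresented p 4 ≃* GTilde p, IsStandardOnGenerators φ) := by
  have h4 := exists_isStandardOnGenerators (p := p) toGL_four_injective
    (le_antisymm (by rintro _ ⟨x, rfl⟩; exact toGL_mem_GTilde 4 x) GTilde_le_range)
  refine ⟨?_, exists_isStandardOnGenerators toGL_injective
    (le_antisymm range_le_GZero GZero_le_range), h4⟩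
  obtain ⟨φ, -⟩ := h4
  have : Finite {r | AbelsRelator p 4 r} := finite_relators p 4
  exact Group.IsFinitelyPresented.equiv φ
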